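/- For $\lambda\in\mathbb{C}$, $n\ge 0$, $t\in\mathbb{C}^{n+1}$ and $s\in\mathbb{C}^{n}$ put $$W_n(\lambda;s)=\prod_{1\le j<k\le n}[4\sinh^2(s_j-s_k)]^{\lambda},\qquad \mathcal{K}^\sharp_{n+1}(\lambda;t,s)=\prod_{j=1}^{n+1}\prod_{k=1}^{n}[2\cosh(t_j-s_k)]^{-\lambda},$$ with principal powers. For $v\in\mathbb{C}^N$ let $V_N=\frac1N\sum_{j}v_j$, $v^{(N)}_j=v_j-V_N$; in particular this defines $T_N,U_N,t^{(N)},u^{(N)}$ for $t,u\in\mathbb{C}^N$. Let $\phi_N(t)=\frac12(\max_j\operatorname{Im}t_j+\min_j\operatorname{Im}t_j)$, $\mu_N(t)=\max_j|\operatorname{Im}t^{(N)}_j|$ and $\mathcal{A}_N^r=\{t\in\mathbb{C}^N:\mu_N(t)<\pi/2\}$. Define $F_1(\lambda;t,u)=e^{itu}$ and, for $N\ge2$, $$F_N(\lambda;t,u)=\frac{e^{iu_N(t_1+\cdots+t_N)}}{(N-1)!}\int_{(\mathbb{R}+i\phi_N(t))^{N-1}}W_{N-1}(\lambda;s)\,\mathcal{K}^\sharp_N(\lambda;t,s)\,F_{N-1}\big(\lambda;s,(u_1-u_N,\ldots,u_{N-1}-u_N)\big)\,ds,$$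 so that the integral is over $\mathbb{R}^{N-1}$ when $t$ is real. Let $$\mathcal{D}_N=\{(\lambda,t,u)\in\mathbb{C}\times\mathcal{A}_N^r\times\mathbb{C}^N:\operatorname{Re}\lambda>1,\ |\operatorname{Im}(u_j-u_k)|<2\operatorname{Re}\lambda\ \text{for all }j,k\},$$ and let $\widehat{\mathcal{D}}_N$ be the set defined by the same conditions with $\operatorname{Re}\lambda\ge1$ in place of $\operatorname{Re}\lambda>1$. **Theorem 6.4.** Let $N\ge1$. (a) For $(\lambda,t,u)\in\widehat{\mathcal{D}}_N$ the integral defining $F_N$ and the integral in $$F_N^r(\lambda;t,u)=\frac1{(N-1)!}\int_{\mathbb{R}^{N-1}}W_{N-1}(\lambda;s)\,\mathcal{K}^\sharp_N(\lambda;t^{(N)},s)\,F_{N-1}\big(\lambda;s,(u_1-u_N,\ldots,u_{N-1}-u_N)\big)\,ds$$ converge absolutely, and $F_N(\lambda;t,u)=\exp(iN\,T_NU_N)\,F_N^r(\lambda;t,u)$. (For $N=1$ read $F_1^r=1$, with no convergence condition.) (b) $F_N$ is holomorphic on $\mathcal{D}_N$ and continuous on $\widehat{\mathcal{D}}_N$.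 (c) There is a real function $C$, continuous on $\{\lambda\in\mathbb{C}:\operatorname{Re}\lambda\ge1\}\times[0,\pi/2)$, such that for all $\lambda$ with $\operatorname{Re}\lambda\ge1$, all $t\in\mathcal{A}_N^r$ with $\operatorname{Re}(t_j-t_k)\ne0$ and all $u\in\mathbb{C}^N$ with $0<|\operatorname{Im}(u_j-u_k)|<2\operatorname{Re}\lambda$ (for $1\le j<k\le N$), $$|F_N(\lambda;t,u)|<C(\lambda,\mu_N(t))\,e^{-N\operatorname{Im}(T_NU_N)}\;\frac{\displaystyle\sum_{\tau\in S_N}(-1)^{\tau}\exp\Big(-\sum_{j=1}^N\operatorname{Re}\big(t^{(N)}_{\tau(j)}\big)\operatorname{Im}\big(u^{(N)}_j\big)\Big)}{\displaystyle\prod_{1\le j<k\le N}\sin\Big(\frac{\pi\operatorname{Im}(u_k-u_j)}{2\operatorname{Re}\lambda}\Big)\sinh\big(\operatorname{Re}\lambda\,\operatorname{Re}(t_j-t_k)\big)},$$ where $(-1)^\tau$ denotes the sign of $\tau$. -/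

import Mathlib

noncomputable section

namespace CalogeroMoser

/-- The weight function `W_n(lam; s) = ∏_{j<k} [4 sinh²(s_j - s_k)]^lam`.
It is only evaluated at `s` with real differences, where the base is a nonnegative real. -/
def weight {n : ℕ} (lam : ℂ) (s : Fin n → ℂ) : ℂ :=
  ∏ j, ∏ k ∈ Finset.Ioi j, (4 * Complex.sinh (s j - s k) ^ 2) ^ lam

/-- The kernel function `K(lam; t, s) = ∏_j ∏_k [2 cosh(t_j - s_k)]^(-lam)`, with `n + 1`
variables `t` and `n` variables `s`. For `|Im (t_j - s_k)| < π/2` the base has positive real part,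
so the principal power is the continuation of the positive power from real arguments. -/
def kernel {n : ℕ} (lam : ℂ) (t : Fin (n + 1) → ℂ) (s : Fin n → ℂ) : ℂ :=
  ∏ j, ∏ k, (2 * Complex.cosh (t j - s k)) ^ (-lam)

/-- The point of the shifted contour `(ℝ + i c)^n` with real parts `s`. -/
def contour {n : ℕ} (c : ℝ) (s : Fin n → ℝ) : Fin n → ℂ :=
  fun j => (s j : ℂ) + Complex.I * (c : ℂ)

/-- Half the sum of the largest and the smallest of the imaginary parts of `t_1, …, t_N`. -/
def midHeight {N : ℕ} (t : Fin N → ℂ) : ℝ :=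
  ((⨆ j, (t j).im) + ⨅ j, (t j).im) / 2

/-- The integrand of one recursion step, parametrized over `(ℝ + i c)^n`: weight, times kernel,
times the function `G` of `n` variables at spectral parameters
`(u_1 - u_{n+1}, …, u_n - u_{n+1})`. -/
def stepIntegrand {n : ℕ} (G : (Fin n → ℂ) → (Fin n → ℂ) → ℂ) (lam : ℂ)
    (t u : Fin (n + 1) → ℂ) (c : ℝ) (s : Fin n → ℝ) : ℂ :=
  weight lam (contour c s) * kernel lam t (contour c s) *
    G (contour c s) (fun j => u j.castSucc - u (Fin.last n))

/-- The function `F_N(lam; t, u)`, defined recursively in `N`. For real `t` the contour is `ℝ^n`;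
for general `t` it is shifted to the height `midHeight t`. Starting at `N = 0` with the
constant `1` gives `F_1(t, u) = exp(i t u)`, the integral over `ℝ^0` being evaluation at a point. -/
def F : (N : ℕ) → ℂ → (Fin N → ℂ) → (Fin N → ℂ) → ℂ
  | 0, _, _, _ => 1
  | n + 1, lam, t, u =>
      Complex.exp (Complex.I * u (Fin.last n) * ∑ j, t j) / (n.factorial : ℂ) *
        ∫ s : Fin n → ℝ, stepIntegrand (F n lam) lam t u (midHeight t) s

/-- The mean `V_N` of the entries of a vector `v`. -/
def mean {N : ℕ} (v : Fin N → ℂ) : ℂ := (∑ j, v j) / (N : ℂ)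

/-- The vector `v^{(N)}` with entries `v_j - V_N`. -/
def relative {N : ℕ} (v : Fin N → ℂ) : Fin N → ℂ := fun j => v j - mean v

/-- The maximum `μ_N(t)` of the `|Im t^{(N)}_j|`. -/
def maxIm {N : ℕ} (t : Fin N → ℂ) : ℝ := ⨆ j, |(relative t j).im|

/-- The reduced function `F_N^r(lam; t, u)` for `N = n + 1`. -/
def reducedF {n : ℕ} (lam : ℂ) (t u : Fin (n + 1) → ℂ) : ℂ :=
  1 / (n.factorial : ℂ) * ∫ s : Fin n → ℝ, stepIntegrand (F n lam) lam (relative t) u 0 s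

/-- The set `A_N^r`. -/
def reducedDomain (N : ℕ) : Set (Fin N → ℂ) := {t | maxIm t < Real.pi / 2}

/-- The domain `D_N` of triples `(lam, t, u)`. -/
def holoDomain (N : ℕ) : Set (ℂ × (Fin N → ℂ) × (Fin N → ℂ)) :=
  {p | 1 < p.1.re ∧ p.2.1 ∈ reducedDomain N ∧
    ∀ j k, |(p.2.2 j - p.2.2 k).im| < 2 * p.1.re}

/-- The set `D_N` with its boundary part `Re lam = 1` added. -/
def extDomain (N : ℕ) : Set (ℂ × (Fin N → ℂ) × (Fin N → ℂ)) :=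
  {p | 1 ≤ p.1.re ∧ p.2.1 ∈ reducedDomain N ∧
    ∀ j k, |(p.2.2 j - p.2.2 k).im| < 2 * p.1.re}

/-- The alternating sum `∑_τ (-)^τ exp(-∑_j Re(t^{(N)}_{τ(j)}) Im(u^{(N)}_j))`. -/
def altSum {N : ℕ} (t u : Fin N → ℂ) : ℝ :=
  ∑ τ : Equiv.Perm (Fin N), ((Equiv.Perm.sign τ : ℤ) : ℝ) *
    Real.exp (-∑ j, (relative t (τ j)).re * (relative u j).im)

/-- The product `∏_{j<k} sin(π Im(u_k - u_j) / (2 Re lam)) sinh(Re lam Re(t_j - t_k))`. -/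
def boundDenom {N : ℕ} (lam : ℂ) (t u : Fin N → ℂ) : ℝ :=
  ∏ j, ∏ k ∈ Finset.Ioi j,
    (Real.sin (Real.pi * (u k - u j).im / (2 * lam.re)) *
      Real.sinh (lam.re * (t j - t k).re))

end CalogeroMoser

end

/-!
Bound each integrand by its absolute value at purely imaginary spectral parameters. There the
recursion has a nonnegative integrand, and comparing `sinh` and `cosh` of `l a` with powers of
`sinh a` and `cosh a` reduces the coupling `l ≥ 1` to coupling one, at the cost of a constant.
At coupling one the kernel times the square root of the weight is a Cauchy determinant, and the
recursion is solved in closed form by the Laplace transform of `tanh`; this is the bound by the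
alternating sum, which also gives absolute convergence for pairwise distinct parameters.

For the regularity, the majorant is log-convex in the spectral parameters and so is bounded on a
convex hull by its values at generic vertices. The resulting local integrable bounds show that the
integral is continuous and holomorphic, by induction on the number of variables. Translating `t`
by a complex number multiplies `F` by an exponential; the normalized integral is a holomorphic
function of the translation that does not change under real translations, so it is constant, and
the contour may be shifted.
-/

noncomputable section

namespace CalogeroMoser

open MeasureTheory Filter Topology

open scoped ENNReal

/-! ### Cauchy's determinant -/

theorem prod_Ioi_castSucc {M : Type*} [CommMonoid M] {n : ℕ} (f : Fin (n + 1) → Fin (n + 1) → M) :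
    ∏ j, ∏ k ∈ Finset.Ioi j, f j k =
      (∏ j : Fin n, ∏ k ∈ Finset.Ioi j, f j.castSucc k.castSucc) *
        ∏ j : Fin n, f j.castSucc (Fin.last n) := by
  have insert_last (j : Fin n) : Finset.Ioi j.castSucc =
      Finset.cons (Fin.last n) ((Finset.Ioi j).map Fin.castSuccEmb) (by simp) := by
    ext k
    cases k using Fin.lastCases <;> simp [Fin.castSucc_lt_last, Fin.le_last]
  rw [Fin.prod_univ_castSucc, ← Fin.top_eq_last, Finset.Ioi_top, Finset.prod_empty, mul_one,
    ← Finset.prod_mul_distrib]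
  refine Finset.prod_congr rfl fun j _ => ?_
  rw [insert_last, Finset.prod_cons, Finset.prod_map, mul_comm]
  rfl

section Bordered

variable {R : Type*} [CommRing R] {n : ℕ}

/-- The square matrix obtained from an `(n + 1) × n` matrix by appending a column of ones: the
shape of Cauchy's determinant when there is one more row than there are columns. -/
def bordered (g : Fin (n + 1) → Fin n → R) : Matrix (Fin (n + 1)) (Fin (n + 1)) R :=
  Matrix.of fun j => Fin.snoc (α := fun _ => R) (g j) 1

@[simp]
theorem bordered_castSucc (g : Fin (n + 1) → Fin n → R) (j : Fin (n + 1)) (k : Fin n) :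
    bordered g j k.castSucc = g j k := by
  simp [bordered]

@[simp]
theorem bordered_last (g : Fin (n + 1) → Fin n → R) (j : Fin (n + 1)) :
    bordered g j (Fin.last n) = 1 := by
  simp [bordered]

theorem det_bordered (g : Fin (n + 1) → Fin n → R) :
    (bordered g).det =
      ∑ σ : Equiv.Perm (Fin (n + 1)), ((Equiv.Perm.sign σ : ℤ) : R) *
        ∏ k : Fin n, g (σ k.castSucc) k := by
  simp [Matrix.det_apply', Fin.prod_univ_castSucc]

theorem det_bordered_add (g : Fin (n + 1) → Fin n → R) (b : Fin n → R) :
    (bordered fun j k => g j k + b k).det = (bordered g).det := by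
  rw [← Matrix.det_transpose, ← Matrix.det_transpose (bordered g)]
  refine Matrix.det_eq_of_forall_row_eq_smul_add_const (Fin.snoc (α := fun _ => R) b 0)
    (Fin.last n) (by simp) fun i j => ?_
  cases i using Fin.lastCases <;> simp

theorem det_bordered_mul (a : Fin n → R) (g : Fin (n + 1) → Fin n → R) :
    (bordered fun j k => a k * g j k).det = (∏ k, a k) * (bordered g).det := by
  have scaled : (bordered fun j k => a k * g j k) = Matrix.of fun i j =>
      (Fin.snoc (α := fun _ => R) a 1 : Fin (n + 1) → R) j * bordered g i j := by
    ext i j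
    cases j using Fin.lastCases <;> simp
  rw [scaled, Matrix.det_mul_row, Fin.prod_univ_castSucc]
  simp

theorem det_bordered_eq_det_sub (g : Fin (n + 1) → Fin n → R) :
    (bordered g).det =
      (Matrix.of fun j k : Fin n => g j.castSucc k - g (Fin.last n) k).det := by
  have subtract_last_row : (bordered g).det = (Matrix.of fun i j =>
      (Fin.lastCases (motive := fun _ => R) (bordered g (Fin.last n) j)
        (fun i' => bordered g i'.castSucc j - bordered g (Fin.last n) j) i)).det := by
    refine Matrix.det_eq_of_forall_row_eq_smul_add_const
      (Fin.snoc (α := fun _ => R) (fun _ => 1) 0) (Fin.last n) (by simp) fun i j => ?_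
    cases i using Fin.lastCases <;> simp
  rw [subtract_last_row, Matrix.det_succ_column _ (Fin.last n), Fin.sum_univ_castSucc]
  simp only [Matrix.of_apply, Fin.lastCases_castSucc, bordered_last, sub_self, mul_zero, zero_mul,
    Finset.sum_const_zero, zero_add, Fin.lastCases_last, mul_one, Even.neg_one_pow ⟨_, rfl⟩,
    one_mul]
  congr 1
  ext i j
  simp [Matrix.submatrix]

end Bordered

section Products

variable {n : ℕ}

/-- The product `∏_{j<k} 2 sinh (s_j - s_k)`, a square root of `weight 1 s` for real `s`. -/
def sinhProd (s : Fin n → ℝ) : ℝ :=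
  ∏ j, ∏ k ∈ Finset.Ioi j, 2 * Real.sinh (s j - s k)

/-- The product `∏_j ∏_k 2 cosh (x_j - s_k)`, the inverse of `kernel 1 x s` for real arguments. -/
def coshProd (x : Fin (n + 1) → ℝ) (s : Fin n → ℝ) : ℝ :=
  ∏ j, ∏ k, 2 * Real.cosh (x j - s k)

/-- The hyperbolic Cauchy kernel with `n + 1` variables `x` and `n` variables `s`. -/
def cauchyKernel (x : Fin (n + 1) → ℝ) (s : Fin n → ℝ) : ℝ :=
  sinhProd x * sinhProd s / coshProd x s

theorem coshProd_pos (x : Fin (n + 1) → ℝ) (s : Fin n → ℝ) : 0 < coshProd x s :=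
  Finset.prod_pos fun _ _ => Finset.prod_pos fun _ _ => mul_pos two_pos (Real.cosh_pos _)

theorem sinhProd_ne_zero {s : Fin n → ℝ} (hs : Function.Injective s) : sinhProd s ≠ 0 := by
  refine Finset.prod_ne_zero_iff.2 fun j _ => Finset.prod_ne_zero_iff.2 fun k hk => ?_
  have : s j ≠ s k := hs.ne (Finset.mem_Ioi.1 hk).ne
  simpa [Real.sinh_eq_zero, sub_eq_zero] using this

theorem sinhProd_comp_perm (s : Fin n → ℝ) (τ : Equiv.Perm (Fin n)) :
    sinhProd (s ∘ τ) = ((Equiv.Perm.sign τ : ℤ) : ℝ) * sinhProd s :=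
  τ.prod_Ioi_comp_eq_sign_mul_prod (f := fun j k => 2 * Real.sinh (s j - s k)) fun i j => by
    rw [← neg_sub (s j), Real.sinh_neg, mul_neg]

theorem coshProd_comp_perm (x : Fin (n + 1) → ℝ) (s : Fin n → ℝ) (τ : Equiv.Perm (Fin n)) :
    coshProd x (s ∘ τ) = coshProd x s :=
  Finset.prod_congr rfl fun j _ => Equiv.prod_comp τ fun k => 2 * Real.cosh (x j - s k)

@[fun_prop]
theorem continuous_sinhProd : Continuous (sinhProd (n := n)) := by
  unfold sinhProd; fun_prop

@[fun_prop]
theorem continuous_coshProd : Continuous fun p : (Fin (n + 1) → ℝ) × (Fin n → ℝ) =>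
    coshProd p.1 p.2 := by
  unfold coshProd; fun_prop

end Products

theorem tanh_sub_tanh_eq (y b s c : ℝ) :
    Real.tanh (y - s) - Real.tanh (b - s) =
      2 / (2 * Real.cosh (b - s)) * (2 * Real.sinh (y - b) / (2 * Real.cosh (y - c)) *
        (Real.sinh (s - c) * Real.tanh (y - s) + Real.cosh (s - c))) := by
  have hy := (Real.cosh_pos (y - s)).ne'
  have hb := (Real.cosh_pos (b - s)).ne'
  have hc := (Real.cosh_pos (y - c)).ne'
  have sinh_yb : Real.sinh (y - b) =
      Real.sinh (y - s) * Real.cosh (b - s) - Real.cosh (y - s) * Real.sinh (b - s) := by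
    rw [← Real.sinh_sub]; congr 1; ring
  have cosh_yc : Real.cosh (y - c) =
      Real.cosh (y - s) * Real.cosh (s - c) + Real.sinh (y - s) * Real.sinh (s - c) := by
    rw [← Real.cosh_add]; congr 1; ring
  have last_factor : Real.sinh (s - c) * Real.tanh (y - s) + Real.cosh (s - c) =
      Real.cosh (y - c) / Real.cosh (y - s) := by
    rw [cosh_yc, Real.tanh_eq_sinh_div_cosh]; field_simp; ring
  rw [last_factor, sinh_yb, Real.tanh_eq_sinh_div_cosh, Real.tanh_eq_sinh_div_cosh]
  field_simp

theorem det_bordered_tanh_succ {n : ℕ} (y : Fin (n + 2) → ℝ) (s : Fin (n + 1) → ℝ) :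
    (bordered fun j k => Real.tanh (y j - s k)).det =
      (∏ k, 2 / (2 * Real.cosh (y (Fin.last _) - s k))) *
        ((∏ j : Fin (n + 1), 2 * Real.sinh (y j.castSucc - y (Fin.last _)) /
            (2 * Real.cosh (y j.castSucc - s (Fin.last n)))) *
          ((∏ k : Fin n, Real.sinh (s k.castSucc - s (Fin.last n))) *
            (bordered fun (j : Fin (n + 1)) (k : Fin n) =>
              Real.tanh (y j.castSucc - s k.castSucc)).det)) := by
  set b := y (Fin.last _)
  set c := s (Fin.last n) with hc
  have factored : (Matrix.of fun j k : Fin (n + 1) =>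
        Real.tanh (y j.castSucc - s k) - Real.tanh (b - s k)) =
      Matrix.of fun j k => 2 / (2 * Real.cosh (b - s k)) * (Matrix.of fun j k =>
        2 * Real.sinh (y j.castSucc - b) / (2 * Real.cosh (y j.castSucc - c)) *
          (bordered fun j k : Fin _ => Real.sinh (s k.castSucc - c) *
            Real.tanh (y j.castSucc - s k.castSucc) + Real.cosh (s k.castSucc - c)) j k) j k := by
    ext j k
    cases k using Fin.lastCases <;> simp [tanh_sub_tanh_eq _ b _ c, ← hc]
  rw [det_bordered_eq_det_sub, factored, Matrix.det_mul_row, Matrix.det_mul_column,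
    det_bordered_add, det_bordered_mul]

theorem det_bordered_tanh {n : ℕ} (y : Fin (n + 1) → ℝ) (s : Fin n → ℝ) :
    (bordered fun j k => Real.tanh (y j - s k)).det = 2 ^ n * cauchyKernel y s := by
  induction n with
  | zero =>
    rw [det_bordered]
    simp [cauchyKernel, sinhProd, coshProd]
  | succ n ih =>
    have two_sinh_prod : ∏ k : Fin n, 2 * Real.sinh (s k.castSucc - s (Fin.last n)) =
        2 ^ n * ∏ k : Fin n, Real.sinh (s k.castSucc - s (Fin.last n)) := by
      simp [Finset.prod_mul_distrib]
    have hcosh {ι : Type} (t : Finset ι) (f : ι → ℝ) : ∏ k ∈ t, 2 * Real.cosh (f k) ≠ 0 :=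
      Finset.prod_ne_zero_iff.2 fun _ _ => (mul_pos two_pos (Real.cosh_pos _)).ne'
    have hcoshProd := (coshProd_pos (fun j : Fin (n + 1) => y j.castSucc)
      (fun k : Fin n => s k.castSucc)).ne'
    rw [det_bordered_tanh_succ, ih, cauchyKernel, cauchyKernel]
    simp only [sinhProd, coshProd] at hcoshProd ⊢
    rw [prod_Ioi_castSucc fun j k => 2 * Real.sinh (y j - y k),
      prod_Ioi_castSucc fun j k => 2 * Real.sinh (s j - s k), two_sinh_prod,
      Fin.prod_univ_castSucc fun j => ∏ k, 2 * Real.cosh (y j - s k)]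
    simp_rw [Fin.prod_univ_castSucc fun k => 2 * Real.cosh (y (Fin.castSucc _) - s k),
      Finset.prod_div_distrib]
    rw [Finset.prod_mul_distrib (f := fun j : Fin (n + 1) =>
        ∏ k : Fin n, 2 * Real.cosh (y j.castSucc - s k.castSucc)),
      Finset.prod_const, Finset.card_univ, Fintype.card_fin]
    field_simp [hcosh]

theorem cauchyKernel_eq_det {n : ℕ} (y : Fin (n + 1) → ℝ) (s a : Fin n → ℝ) :
    cauchyKernel y s = (2 ^ n)⁻¹ * (bordered fun j k => Real.tanh (y j - s k) - a k).det := by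
  have shifted := det_bordered_add (fun j k => Real.tanh (y j - s k)) fun k => -a k
  simp only [← sub_eq_add_neg] at shifted
  rw [shifted, det_bordered_tanh, inv_mul_cancel_left₀ (by positivity)]

/-! ### The Laplace transform of the hyperbolic tangent -/

section Beta

variable {α β : ℝ}

theorem ofReal_rpow_mul_one_sub_rpow {x : ℝ} (hx : x ∈ Set.Ioo 0 1) :
    ((x ^ (α - 1) * (1 - x) ^ (β - 1) : ℝ) : ℂ) =
      (x : ℂ) ^ ((α : ℂ) - 1) * (1 - (x : ℂ)) ^ ((β : ℂ) - 1) := by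
  push_cast [Complex.ofReal_cpow hx.1.le, Complex.ofReal_cpow (sub_pos.2 hx.2).le]
  rfl

theorem integrableOn_rpow_mul_one_sub_rpow (hα : 0 < α) (hβ : 0 < β) :
    IntegrableOn (fun x : ℝ => x ^ (α - 1) * (1 - x) ^ (β - 1)) (Set.Ioo 0 1) := by
  have convergent := Complex.betaIntegral_convergent (u := α) (v := β) (by simpa) (by simpa)
  rw [intervalIntegrable_iff_integrableOn_Ioo_of_le zero_le_one] at convergent
  refine IntegrableOn.congr_fun convergent.re (fun x hx => ?_) measurableSet_Ioo
  rw [← ofReal_rpow_mul_one_sub_rpow hx]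
  exact Complex.ofReal_re _

theorem integral_rpow_mul_one_sub_rpow (hα : 0 < α) (hβ : 0 < β) :
    ∫ x in Set.Ioo (0 : ℝ) 1, x ^ (α - 1) * (1 - x) ^ (β - 1) = ProbabilityTheory.beta α β := by
  rw [ProbabilityTheory.beta_eq_betaIntegralReal α β hα hβ, Complex.betaIntegral,
    intervalIntegral.integral_of_le zero_le_one, integral_Ioc_eq_integral_Ioo,
    ← setIntegral_congr_fun measurableSet_Ioo fun x hx => ofReal_rpow_mul_one_sub_rpow hx,
    integral_complex_ofReal, Complex.ofReal_re]

end Beta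

theorem sigmoid_mul_exp_eq (α r : ℝ) :
    Real.sigmoid r * Real.exp (-(α * r)) = |Real.sigmoid r * (1 - Real.sigmoid r)| •
      (Real.sigmoid r ^ (1 - α - 1) * (1 - Real.sigmoid r) ^ (α - 1)) := by
  have hpos := Real.sigmoid_pos r
  have hpos' := sub_pos.2 (Real.sigmoid_lt_one r)
  have exp_neg : Real.exp (-(α * r)) = ((1 - Real.sigmoid r) / Real.sigmoid r) ^ α := by
    rw [← Real.sigmoid_neg, ← Real.sigmoid_mul_rexp_neg, mul_div_cancel_left₀ _ hpos.ne',
      ← Real.exp_mul]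
    congr 1; ring
  rw [exp_neg, abs_of_pos (mul_pos hpos hpos'), sub_sub_cancel_left, Real.rpow_neg hpos.le,
    Real.rpow_sub_one hpos'.ne', Real.div_rpow hpos'.le hpos.le, smul_eq_mul]
  field_simp

theorem integrable_sigmoid_mul_exp {α : ℝ} (h0 : 0 < α) (h1 : α < 1) :
    Integrable fun r : ℝ => Real.sigmoid r * Real.exp (-(α * r)) := by
  simp_rw [sigmoid_mul_exp_eq, ← integrableOn_univ]
  rw [← integrableOn_image_iff_integrableOn_abs_deriv_smul MeasurableSet.univ
    (fun r _ => (Real.hasDerivAt_sigmoid r).hasDerivWithinAt) Real.sigmoid_injective.injOn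
    (fun x => x ^ (1 - α - 1) * (1 - x) ^ (α - 1)), Set.image_univ, Real.range_sigmoid]
  exact integrableOn_rpow_mul_one_sub_rpow (sub_pos.2 h1) h0

theorem integral_sigmoid_mul_exp {α : ℝ} (h0 : 0 < α) (h1 : α < 1) :
    ∫ r : ℝ, Real.sigmoid r * Real.exp (-(α * r)) = Real.pi / Real.sin (Real.pi * α) := by
  simp_rw [sigmoid_mul_exp_eq]
  rw [← setIntegral_univ, ← integral_image_eq_integral_abs_deriv_smul MeasurableSet.univ
    (fun r _ => (Real.hasDerivAt_sigmoid r).hasDerivWithinAt) Real.sigmoid_injective.injOn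
    (fun x => x ^ (1 - α - 1) * (1 - x) ^ (α - 1)), Set.image_univ, Real.range_sigmoid,
    integral_rpow_mul_one_sub_rpow (sub_pos.2 h1) h0, ProbabilityTheory.beta, sub_add_cancel,
    Real.Gamma_one, div_one, mul_comm, Real.Gamma_mul_Gamma_one_sub]

theorem tanh_eq_one_sub_sigmoid (r : ℝ) : Real.tanh r = 1 - 2 * Real.sigmoid (-(2 * r)) := by
  rw [Real.sigmoid_def, neg_neg, Real.tanh_eq_sinh_div_cosh, Real.sinh_eq, Real.cosh_eq,
    Real.exp_neg, two_mul r, Real.exp_add]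
  field_simp
  ring

theorem tanh_sub_sign_mul_exp {w : ℝ} (hw : w ≠ 0) (y s : ℝ) :
    (Real.tanh (y - s) - Real.sign w) * Real.exp (-(s * w)) =
      -(2 * Real.sign w * Real.exp (-(y * w))) * (Real.sigmoid (2 * Real.sign w * (s - y)) *
        Real.exp (-(|w| / 2 * (2 * Real.sign w * (s - y))))) := by
  have exp_split : Real.exp (-(s * w)) = Real.exp (-(y * w)) * Real.exp (-((s - y) * w)) := by
    rw [← Real.exp_add]; ring_nf
  rw [exp_split, tanh_eq_one_sub_sigmoid]
  rcases hw.lt_or_gt with hneg | hpos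
  · rw [Real.sign_of_neg hneg, abs_of_neg hneg, Real.sigmoid_neg]
    ring_nf
  · rw [Real.sign_of_pos hpos, abs_of_pos hpos]
    ring_nf

theorem integrable_tanh_sub_sign {w : ℝ} (hw : w ≠ 0) (hw2 : |w| < 2) (y : ℝ) :
    Integrable fun s : ℝ => (Real.tanh (y - s) - Real.sign w) * Real.exp (-(s * w)) := by
  simp_rw [tanh_sub_sign_mul_exp hw y]
  refine Integrable.const_mul (Integrable.comp_sub_right (f := fun r => Real.sigmoid
    (2 * Real.sign w * r) * Real.exp (-(|w| / 2 * (2 * Real.sign w * r)))) ?_ y) _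
  exact (integrable_sigmoid_mul_exp (half_pos (abs_pos.2 hw)) (by linarith)).comp_mul_left'
    (mul_ne_zero two_ne_zero (Real.sign_eq_zero_iff.not.2 hw))

theorem integral_tanh_sub_sign {w : ℝ} (hw : w ≠ 0) (hw2 : |w| < 2) (y : ℝ) :
    ∫ s : ℝ, (Real.tanh (y - s) - Real.sign w) * Real.exp (-(s * w)) =
      -(Real.pi / Real.sin (Real.pi * w / 2)) * Real.exp (-(y * w)) := by
  simp_rw [tanh_sub_sign_mul_exp hw y]
  rw [integral_const_mul, integral_sub_right_eq_self (fun r => Real.sigmoid (2 * Real.sign w * r) *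
      Real.exp (-(|w| / 2 * (2 * Real.sign w * r)))) y,
    Measure.integral_comp_mul_left fun r => Real.sigmoid r * Real.exp (-(|w| / 2 * r)),
    integral_sigmoid_mul_exp (half_pos (abs_pos.2 hw)) (by linarith), smul_eq_mul]
  rcases hw.lt_or_gt with hneg | hpos
  · rw [Real.sign_of_neg hneg, abs_of_neg hneg, neg_div, mul_neg Real.pi, Real.sin_neg]
    norm_num
    ring_nf
  · rw [Real.sign_of_pos hpos, abs_of_pos hpos]
    norm_num
    ring_nf

/-! ### The recursion at imaginary spectral parameters -/

theorem ae_injective (ι : Type*) [Fintype ι] : ∀ᵐ s : ι → ℝ, Function.Injective s := by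
  have ae_ne (j k : ι) (hjk : j ≠ k) : ∀ᵐ s : ι → ℝ, s j ≠ s k := by
    classical
    let diagonal : Submodule ℝ (ι → ℝ) :=
      LinearMap.ker (LinearMap.proj (R := ℝ) (φ := fun _ : ι => ℝ) j - LinearMap.proj k)
    have proper : diagonal ≠ ⊤ := fun h => by
      have : (Pi.single j 1 : ι → ℝ) ∈ diagonal := h ▸ Submodule.mem_top
      simp [diagonal, hjk.symm] at this
    filter_upwards [measure_eq_zero_iff_ae_notMem.1
      (Measure.addHaar_submodule volume diagonal proper)] with s hs h
    exact hs (by simp [diagonal, h])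
  have ae_forall_ne : ∀ᵐ s : ι → ℝ, ∀ j k, j ≠ k → s j ≠ s k := by
    simpa only [ae_all_iff] using ae_ne
  filter_upwards [ae_forall_ne] with s hs j k
  exact not_imp_not.1 (hs j k)

theorem measurePreserving_comp_perm {ι : Type*} [Fintype ι] (τ : Equiv.Perm ι) :
    MeasurePreserving fun s : ι → ℝ => s ∘ τ :=
  volume_preserving_arrowCongr' τ.symm (MeasurableEquiv.refl ℝ) (.id _)

variable {n : ℕ}

/-- The differences `v_j - v_{n+1}` for `j ≤ n`: the spectral parameters of the recursion. -/
def dropLast {R : Type*} [Sub R] (v : Fin (n + 1) → R) : Fin n → R :=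
  fun j => v j.castSucc - v (Fin.last n)

theorem dropLast_sub_dropLast {R : Type*} [AddGroup R] (v : Fin (n + 1) → R) (j k : Fin n) :
    dropLast v j - dropLast v k = v j.castSucc - v k.castSucc :=
  sub_sub_sub_cancel_right _ _ _

/-- The product of weight and kernel in the recursion, at a real coupling `l` and real arguments. -/
def stepDensity (l : ℝ) (x : Fin (n + 1) → ℝ) (s : Fin n → ℝ) : ℝ :=
  |sinhProd s| ^ (2 * l) / coshProd x s ^ l

theorem stepDensity_nonneg (l : ℝ) (x : Fin (n + 1) → ℝ) (s : Fin n → ℝ) :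
    0 ≤ stepDensity l x s :=
  div_nonneg (Real.rpow_nonneg (abs_nonneg _) _) (Real.rpow_nonneg (coshProd_pos x s).le _)

theorem stepDensity_pos (l : ℝ) (x : Fin (n + 1) → ℝ) {s : Fin n → ℝ}
    (hs : Function.Injective s) : 0 < stepDensity l x s :=
  div_pos (Real.rpow_pos_of_pos (abs_pos.2 (sinhProd_ne_zero hs)) _)
    (Real.rpow_pos_of_pos (coshProd_pos x s) _)

theorem measurable_stepDensity (l : ℝ) :
    Measurable fun p : (Fin (n + 1) → ℝ) × (Fin n → ℝ) => stepDensity l p.1 p.2 := by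
  have := (continuous_sinhProd (n := n)).measurable
  have := (continuous_coshProd (n := n)).measurable
  unfold stepDensity
  fun_prop

/-- The function `F` at a real coupling `l`, real variables `x` and purely imaginary spectral
parameters `I * v`, as an extended nonnegative real. There the integrand is nonnegative, so that
the recursion makes sense before its convergence is known. -/
def majorant : (n : ℕ) → ℝ → (Fin n → ℝ) → (Fin n → ℝ) → ℝ≥0∞
  | 0, _, _, _ => 1
  | n + 1, l, x, v =>
      ENNReal.ofReal (Real.exp (-(v (Fin.last n) * ∑ j, x j)) / n.factorial) *
        ∫⁻ s : Fin n → ℝ, ENNReal.ofReal (stepDensity l x s) * majorant n l s (dropLast v)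

theorem measurable_majorant (l : ℝ) (v : Fin n → ℝ) : Measurable fun x => majorant n l x v := by
  induction n with
  | zero => exact measurable_const
  | succ n ih =>
    simp only [majorant]
    refine Measurable.mul (by fun_prop) (Measurable.lintegral_prod_right'
      (f := fun p : (Fin (n + 1) → ℝ) × (Fin n → ℝ) =>
        ENNReal.ofReal (stepDensity l p.1 p.2) * majorant n l p.2 (dropLast v)) ?_)
    exact (measurable_stepDensity l).ennreal_ofReal.mul ((ih (dropLast v)).comp measurable_snd)

theorem measurable_majorant_integrand (l : ℝ) (x : Fin (n + 1) → ℝ) (v : Fin n → ℝ) :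
    Measurable fun s => ENNReal.ofReal (stepDensity l x s) * majorant n l s v :=
  ((measurable_stepDensity l).comp measurable_prodMk_left).ennreal_ofReal.mul
    (measurable_majorant l v)

theorem majorant_pos (l : ℝ) (x v : Fin n → ℝ) : 0 < majorant n l x v := by
  induction n with
  | zero => exact one_pos
  | succ n ih =>
    refine ENNReal.mul_pos (ENNReal.ofReal_pos.2 (by positivity)).ne' fun integral_eq_zero => ?_
    obtain ⟨s, hs, integrand_eq_zero⟩ := ((ae_injective (Fin n)).and
      ((lintegral_eq_zero_iff (measurable_majorant_integrand l x _)).1 integral_eq_zero)).exists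
    exact (ENNReal.mul_pos (ENNReal.ofReal_pos.2 (stepDensity_pos l x hs)).ne'
      (ih s (dropLast v)).ne').ne' integrand_eq_zero

/-! ### The closed form at coupling one -/

theorem cauchyKernel_comp_perm (y : Fin (n + 1) → ℝ) (s : Fin n → ℝ) (τ : Equiv.Perm (Fin n)) :
    cauchyKernel y (s ∘ τ) = ((Equiv.Perm.sign τ : ℤ) : ℝ) * cauchyKernel y s := by
  rw [cauchyKernel, cauchyKernel, sinhProd_comp_perm, coshProd_comp_perm]
  ring

theorem cauchyKernel_mul_exp_eq_sum (y : Fin (n + 1) → ℝ) (s w : Fin n → ℝ) :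
    cauchyKernel y s * ∏ k, Real.exp (-(s k * w k)) =
      ∑ σ : Equiv.Perm (Fin (n + 1)), (2 ^ n)⁻¹ * ((Equiv.Perm.sign σ : ℤ) : ℝ) *
        ∏ k : Fin n, (Real.tanh (y (σ k.castSucc) - s k) - Real.sign (w k)) *
          Real.exp (-(s k * w k)) := by
  rw [cauchyKernel_eq_det y s fun k => Real.sign (w k), det_bordered, Finset.mul_sum,
    Finset.sum_mul]
  refine Finset.sum_congr rfl fun σ _ => ?_
  rw [Finset.prod_mul_distrib]
  ring

theorem integrable_cauchyKernel_summand (y : Fin (n + 1) → ℝ) {w : Fin n → ℝ}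
    (hw : ∀ k, w k ≠ 0) (hw2 : ∀ k, |w k| < 2) (σ : Equiv.Perm (Fin (n + 1))) :
    Integrable fun s : Fin n → ℝ => (2 ^ n)⁻¹ * ((Equiv.Perm.sign σ : ℤ) : ℝ) *
      ∏ k : Fin n, (Real.tanh (y (σ k.castSucc) - s k) - Real.sign (w k)) *
        Real.exp (-(s k * w k)) :=
  (Integrable.fintype_prod fun k =>
    integrable_tanh_sub_sign (hw k) (hw2 k) (y (σ k.castSucc))).const_mul _

theorem integrable_cauchyKernel_mul_exp (y : Fin (n + 1) → ℝ) {w : Fin n → ℝ}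
    (hw : ∀ k, w k ≠ 0) (hw2 : ∀ k, |w k| < 2) :
    Integrable fun s => cauchyKernel y s * ∏ k, Real.exp (-(s k * w k)) := by
  simp_rw [cauchyKernel_mul_exp_eq_sum]
  exact integrable_finsetSum _ fun σ _ => integrable_cauchyKernel_summand y hw hw2 σ

theorem integral_cauchyKernel_mul_exp (y : Fin (n + 1) → ℝ) {w : Fin n → ℝ}
    (hw : ∀ k, w k ≠ 0) (hw2 : ∀ k, |w k| < 2) :
    ∫ s, cauchyKernel y s * ∏ k, Real.exp (-(s k * w k)) =
      (∏ k, Real.pi / (2 * Real.sin (-(Real.pi * w k / 2)))) *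
        ∑ σ : Equiv.Perm (Fin (n + 1)), ((Equiv.Perm.sign σ : ℤ) : ℝ) *
          ∏ k : Fin n, Real.exp (-(y (σ k.castSucc) * w k)) := by
  simp_rw [cauchyKernel_mul_exp_eq_sum]
  rw [integral_finsetSum _ fun σ _ => integrable_cauchyKernel_summand y hw hw2 σ, Finset.mul_sum]
  refine Finset.sum_congr rfl fun σ _ => ?_
  rw [integral_const_mul, integral_fintype_prod_volume_eq_prod fun k r =>
    (Real.tanh (y (σ k.castSucc) - r) - Real.sign (w k)) * Real.exp (-(r * w k))]
  have coeff_eq (x : ℝ) : -(Real.pi / Real.sin x) = 2 * (Real.pi / (2 * Real.sin (-x))) := by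
    rw [Real.sin_neg]; ring
  simp only [fun k => integral_tanh_sub_sign (hw k) (hw2 k), coeff_eq, Finset.prod_mul_distrib,
    Finset.prod_const, Finset.card_univ, Fintype.card_fin]
  field_simp

/-- The matrix with entries `exp (-(y_i w_j))`. Its determinant is the alternating sum in the bound
for `F`. -/
def expMatrix (y w : Fin n → ℝ) : Matrix (Fin n) (Fin n) ℝ :=
  Matrix.of fun i j => Real.exp (-(y i * w j))

theorem det_expMatrix (y w : Fin n → ℝ) :
    (expMatrix y w).det = ∑ τ : Equiv.Perm (Fin n), ((Equiv.Perm.sign τ : ℤ) : ℝ) *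
      ∏ k, Real.exp (-(y (τ k) * w k)) :=
  Matrix.det_apply' _

theorem det_expMatrix_succ (y w : Fin (n + 1) → ℝ) :
    (expMatrix y w).det = Real.exp (-(w (Fin.last n) * ∑ j, y j)) *
      ∑ σ : Equiv.Perm (Fin (n + 1)), ((Equiv.Perm.sign σ : ℤ) : ℝ) *
        ∏ k : Fin n, Real.exp (-(y (σ k.castSucc) * dropLast w k)) := by
  rw [det_expMatrix, Finset.mul_sum]
  refine Finset.sum_congr rfl fun σ _ => ?_
  rw [mul_left_comm, ← Equiv.sum_comp σ y, ← Real.exp_sum, ← Real.exp_sum, ← Real.exp_add,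
    Fin.sum_univ_castSucc, Fin.sum_univ_castSucc]
  simp only [dropLast, mul_sub, neg_sub, Finset.sum_sub_distrib, Finset.sum_neg_distrib,
    ← Finset.sum_mul]
  ring_nf

theorem cauchyKernel_mul_det (y : Fin (n + 1) → ℝ) (s w : Fin n → ℝ) :
    cauchyKernel y s * (expMatrix s w).det =
      ∑ τ : Equiv.Perm (Fin n),
        cauchyKernel y (s ∘ τ) * ∏ k, Real.exp (-((s ∘ τ) k * w k)) := by
  rw [det_expMatrix, Finset.mul_sum]
  refine Finset.sum_congr rfl fun τ _ => ?_
  rw [cauchyKernel_comp_perm, mul_left_comm, mul_assoc]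
  rfl

theorem integrable_cauchyKernel_comp_perm_mul_exp (y : Fin (n + 1) → ℝ) {w : Fin n → ℝ}
    (hw : ∀ k, w k ≠ 0) (hw2 : ∀ k, |w k| < 2) (τ : Equiv.Perm (Fin n)) :
    Integrable fun s : Fin n → ℝ =>
      cauchyKernel y (s ∘ τ) * ∏ k, Real.exp (-((s ∘ τ) k * w k)) :=
  (measurePreserving_comp_perm τ).integrable_comp_of_integrable
    (integrable_cauchyKernel_mul_exp y hw hw2)

theorem integrable_cauchyKernel_mul_det (y : Fin (n + 1) → ℝ) {w : Fin n → ℝ}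
    (hw : ∀ k, w k ≠ 0) (hw2 : ∀ k, |w k| < 2) :
    Integrable fun s => cauchyKernel y s * (expMatrix s w).det := by
  simp_rw [cauchyKernel_mul_det]
  exact integrable_finsetSum _ fun τ _ => integrable_cauchyKernel_comp_perm_mul_exp y hw hw2 τ

theorem integral_cauchyKernel_mul_det (y : Fin (n + 1) → ℝ) {w : Fin n → ℝ}
    (hw : ∀ k, w k ≠ 0) (hw2 : ∀ k, |w k| < 2) :
    ∫ s, cauchyKernel y s * (expMatrix s w).det =
      n.factorial * ∫ s, cauchyKernel y s * ∏ k, Real.exp (-(s k * w k)) := by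
  simp_rw [cauchyKernel_mul_det]
  rw [integral_finsetSum _ fun τ _ => integrable_cauchyKernel_comp_perm_mul_exp y hw hw2 τ]
  have integral_comp_perm (τ : Equiv.Perm (Fin n)) :
      ∫ s : Fin n → ℝ, cauchyKernel y (s ∘ τ) * ∏ k, Real.exp (-((s ∘ τ) k * w k)) =
        ∫ s, cauchyKernel y s * ∏ k, Real.exp (-(s k * w k)) :=
    (measurePreserving_comp_perm τ).integral_comp
      (MeasurableEquiv.arrowCongr' τ.symm (.refl ℝ)).measurableEmbedding
      fun s => cauchyKernel y s * ∏ k, Real.exp (-(s k * w k))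
  rw [Finset.sum_congr rfl fun τ _ => integral_comp_perm τ]
  simp [Fintype.card_perm]

/-- The sine factors of the closed form of `majorant` at coupling one. -/
def sinProd (w : Fin n → ℝ) : ℝ :=
  ∏ j, ∏ k ∈ Finset.Ioi j, 2 * Real.sin (Real.pi * (w k - w j) / 2)

theorem exp_div_factorial_mul_integral (y w : Fin (n + 1) → ℝ) (hw : Function.Injective w)
    (hw2 : ∀ j k, |w j - w k| < 2) :
    Real.exp (-(w (Fin.last n) * ∑ j, y j)) / n.factorial *
        ((∫ s, cauchyKernel y s * (expMatrix s (dropLast w)).det) / sinProd (dropLast w)) =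
      Real.pi ^ n * (expMatrix y w).det / sinProd w := by
  have dropLast_ne_zero (k : Fin n) : dropLast w k ≠ 0 :=
    sub_ne_zero.2 (hw.ne (Fin.castSucc_lt_last k).ne)
  have sinProd_succ : sinProd w = sinProd (dropLast w) *
      ∏ k, 2 * Real.sin (-(Real.pi * dropLast w k / 2)) := by
    simp only [sinProd, prod_Ioi_castSucc (fun j k => 2 * Real.sin (Real.pi * (w k - w j) / 2)),
      dropLast_sub_dropLast]
    simp only [dropLast, ← neg_div, ← mul_neg, neg_sub]
  rw [integral_cauchyKernel_mul_det y dropLast_ne_zero fun k => hw2 _ _,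
    integral_cauchyKernel_mul_exp y dropLast_ne_zero fun k => hw2 _ _, det_expMatrix_succ,
    sinProd_succ, Finset.prod_div_distrib, Finset.prod_const, Finset.card_univ, Fintype.card_fin]
  field_simp

/-- The value of `majorant` at coupling one. -/
def majorantOne (y w : Fin n → ℝ) : ℝ :=
  Real.pi ^ n.choose 2 * (expMatrix y w).det / (sinProd w * sinhProd y)

theorem majorantOne_succ {y w : Fin (n + 1) → ℝ} (hw : Function.Injective w)
    (hw2 : ∀ j k, |w j - w k| < 2) :
    majorantOne y w = Real.exp (-(w (Fin.last n) * ∑ j, y j)) / n.factorial *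
      ∫ s, Real.pi ^ n.choose 2 / (sinProd (dropLast w) * sinhProd y) *
        (cauchyKernel y s * (expMatrix s (dropLast w)).det) := by
  calc majorantOne y w
      = Real.pi ^ n.choose 2 / sinhProd y *
          (Real.pi ^ n * (expMatrix y w).det / sinProd w) := by
        rw [majorantOne, Nat.choose_succ_succ', Nat.choose_one_right, pow_add]
        ring
    _ = _ := by
        rw [← exp_div_factorial_mul_integral y w hw hw2, integral_const_mul]
        ring

theorem stepDensity_mul_majorantOne {y : Fin (n + 1) → ℝ} (hy : Function.Injective y)
    {s : Fin n → ℝ} (hs : Function.Injective s) (w : Fin n → ℝ) :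
    stepDensity 1 y s * majorantOne s w =
      Real.pi ^ n.choose 2 / (sinProd w * sinhProd y) *
        (cauchyKernel y s * (expMatrix s w).det) := by
  have := sinhProd_ne_zero hs
  have := sinhProd_ne_zero hy
  simp only [stepDensity, majorantOne, cauchyKernel, mul_one, Real.rpow_one, Real.rpow_two, sq_abs]
  field_simp

theorem majorant_one_eq {y w : Fin n → ℝ} (hy : Function.Injective y) (hw : Function.Injective w)
    (hw2 : ∀ j k, |w j - w k| < 2) : majorant n 1 y w = ENNReal.ofReal (majorantOne y w) := by
  induction n with
  | zero => simp [majorant, majorantOne, sinProd, sinhProd]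
  | succ n ih =>
    have dropLast_injective : Function.Injective (dropLast w) := fun j k h =>
      Fin.castSucc_injective n (hw (sub_left_injective h))
    have integrand_eq : ∀ᵐ s : Fin n → ℝ,
        ENNReal.ofReal (stepDensity 1 y s) * majorant n 1 s (dropLast w) =
          ENNReal.ofReal (Real.pi ^ n.choose 2 / (sinProd (dropLast w) * sinhProd y) *
            (cauchyKernel y s * (expMatrix s (dropLast w)).det)) := by
      filter_upwards [ae_injective (Fin n)] with s hs
      rw [ih hs dropLast_injective fun j k => dropLast_sub_dropLast w j k ▸ hw2 _ _,
        ← ENNReal.ofReal_mul (stepDensity_pos 1 y hs).le, stepDensity_mul_majorantOne hy hs]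
    have integrand_nonneg : ∀ᵐ s : Fin n → ℝ,
        0 ≤ Real.pi ^ n.choose 2 / (sinProd (dropLast w) * sinhProd y) *
            (cauchyKernel y s * (expMatrix s (dropLast w)).det) := by
      filter_upwards [ae_injective (Fin n), integrand_eq] with s hs h
      exact (ENNReal.ofReal_pos.1 (h ▸ ENNReal.mul_pos
        (ENNReal.ofReal_pos.2 (stepDensity_pos 1 y hs)).ne' (majorant_pos 1 s _).ne')).le
    have integrable := (integrable_cauchyKernel_mul_det y (w := dropLast w)
      (fun k => sub_ne_zero.2 (hw.ne (Fin.castSucc_lt_last k).ne)) fun k => hw2 _ _).const_mul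
        (Real.pi ^ n.choose 2 / (sinProd (dropLast w) * sinhProd y))
    rw [majorant, lintegral_congr_ae integrand_eq,
      ← ofReal_integral_eq_lintegral_ofReal integrable integrand_nonneg,
      ← ENNReal.ofReal_mul (by positivity), majorantOne_succ hw hw2]

/-! ### Comparison of couplings -/

theorem abs_two_mul_sinh_rpow_le {l : ℝ} (hl : 1 ≤ l) (a : ℝ) :
    |2 * Real.sinh a| ^ l ≤ |2 * Real.sinh (l * a)| := by
  wlog ha : 0 ≤ a generalizing a
  · simpa [Real.sinh_neg, abs_neg] using this (-a) (by linarith)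
  have two_mul_sinh (b : ℝ) : 2 * Real.sinh b = Real.exp b * (1 - Real.exp (-2 * b)) := by
    rw [Real.sinh_eq, mul_sub, ← Real.exp_add]
    ring_nf
  have factor_nonneg : 0 ≤ 1 - Real.exp (-2 * a) := by
    rw [sub_nonneg, Real.exp_le_one_iff]
    linarith
  have factor_le : (1 - Real.exp (-2 * a)) ^ l ≤ 1 - Real.exp (-2 * (l * a)) :=
    calc (1 - Real.exp (-2 * a)) ^ l ≤ 1 - Real.exp (-2 * a) :=
          Real.rpow_le_self_of_le_one factor_nonneg (by linarith [Real.exp_pos (-2 * a)]) hl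
      _ ≤ 1 - Real.exp (-2 * (l * a)) := by
          gcongr 1 - Real.exp ?_
          nlinarith
  rw [abs_of_nonneg (mul_nonneg two_pos.le (Real.sinh_nonneg_iff.2 ha)),
    abs_of_nonneg (mul_nonneg two_pos.le (Real.sinh_nonneg_iff.2 (by positivity))),
    two_mul_sinh, two_mul_sinh, Real.mul_rpow (Real.exp_pos _).le factor_nonneg, ← Real.exp_mul,
    mul_comm a l]
  gcongr

theorem exp_abs_le_two_mul_cosh (a : ℝ) : Real.exp |a| ≤ 2 * Real.cosh a := by
  rw [← Real.cosh_abs, Real.cosh_eq]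
  linarith [Real.exp_pos (-|a|)]

theorem cosh_mul_le {l : ℝ} (hl : 0 ≤ l) (a : ℝ) :
    Real.cosh (l * a) ≤ (2 * Real.cosh a) ^ l :=
  calc Real.cosh (l * a) ≤ Real.exp (l * |a|) := by
        rw [← Real.cosh_abs, abs_mul, abs_of_nonneg hl, Real.cosh_eq]
        have : Real.exp (-(l * |a|)) ≤ Real.exp (l * |a|) := by
          gcongr
          exact neg_le_self (by positivity)
        linarith
    _ = Real.exp |a| ^ l := by rw [mul_comm, Real.exp_mul]
    _ ≤ (2 * Real.cosh a) ^ l :=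
        Real.rpow_le_rpow (Real.exp_pos _).le (exp_abs_le_two_mul_cosh a) hl

theorem abs_sinhProd_rpow_le {l : ℝ} (hl : 1 ≤ l) (s : Fin n → ℝ) :
    |sinhProd s| ^ l ≤ |sinhProd (l • s)| := by
  simp only [sinhProd, Finset.abs_prod]
  rw [← Real.finsetProd_rpow _ _ fun _ _ => by positivity]
  gcongr with j
  rw [← Real.finsetProd_rpow _ _ fun _ _ => by positivity]
  gcongr with k
  simpa [mul_sub] using abs_two_mul_sinh_rpow_le hl (s j - s k)

theorem coshProd_smul_le {l : ℝ} (hl : 0 ≤ l) (x : Fin (n + 1) → ℝ) (s : Fin n → ℝ) :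
    coshProd (l • x) (l • s) ≤ 2 ^ (n * (n + 1)) * coshProd x s ^ l :=
  calc coshProd (l • x) (l • s) ≤ ∏ j, ∏ k, 2 * (2 * Real.cosh (x j - s k)) ^ l := by
        unfold coshProd
        gcongr with j _ k
        simpa [mul_sub] using cosh_mul_le hl (x j - s k)
    _ = 2 ^ (n * (n + 1)) * coshProd x s ^ l := by
        have prod_rpow (j : Fin (n + 1)) : ∏ k, (2 * Real.cosh (x j - s k)) ^ l =
            (∏ k, 2 * Real.cosh (x j - s k)) ^ l :=
          Real.finsetProd_rpow _ _ (fun _ _ => by positivity) l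
        simp_rw [Finset.prod_mul_distrib, prod_rpow]
        rw [Real.finsetProd_rpow _ _ (fun _ _ => by positivity) l]
        simp [coshProd, pow_mul, Finset.prod_mul_distrib]

theorem stepDensity_le_stepDensity_one {l : ℝ} (hl : 1 ≤ l) (x : Fin (n + 1) → ℝ)
    (s : Fin n → ℝ) :
    stepDensity l x s ≤ 2 ^ (n * (n + 1)) * stepDensity 1 (l • x) (l • s) := by
  have := coshProd_pos x s
  have := coshProd_pos (l • x) (l • s)
  calc stepDensity l x s = (|sinhProd s| ^ l) ^ 2 / coshProd x s ^ l := by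
        rw [stepDensity, mul_comm 2 l, Real.rpow_mul (abs_nonneg _), Real.rpow_two]
    _ ≤ |sinhProd (l • s)| ^ 2 /
          ((2 ^ (n * (n + 1)))⁻¹ * coshProd (l • x) (l • s)) := by
        gcongr
        · exact abs_sinhProd_rpow_le hl s
        · rw [inv_mul_le_iff₀ (by positivity)]
          exact coshProd_smul_le (by positivity) x s
    _ = 2 ^ (n * (n + 1)) * stepDensity 1 (l • x) (l • s) := by
        rw [stepDensity, mul_one, Real.rpow_one, Real.rpow_two]
        field_simp

theorem lintegral_comp_smul_le {E : Type*} [NormedAddCommGroup E] [NormedSpace ℝ E]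
    [MeasurableSpace E] [BorelSpace E] [FiniteDimensional ℝ E] (μ : Measure E)
    [μ.IsAddHaarMeasure] {l : ℝ} (hl : 1 ≤ l) {f : E → ℝ≥0∞} (hf : Measurable f) :
    ∫⁻ s, f (l • s) ∂μ ≤ ∫⁻ s, f s ∂μ := by
  rw [← lintegral_map hf (measurable_const_smul l), Measure.map_addHaar_smul _ (by positivity),
    lintegral_smul_measure, smul_eq_mul]
  refine mul_le_of_le_one_left' ?_
  rw [ENNReal.ofReal_le_one, abs_of_nonneg (by positivity)]
  exact inv_le_one_of_one_le₀ (one_le_pow₀ hl)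

theorem majorant_le_majorant_one {l : ℝ} (hl : 1 ≤ l) (x v : Fin n → ℝ) :
    majorant n l x v ≤ ENNReal.ofReal (2 ^ ∑ m ∈ Finset.range n, m * (m + 1)) *
      majorant n 1 (l • x) (l⁻¹ • v) := by
  induction n with
  | zero => simp [majorant]
  | succ n ih =>
    set c : ℝ := 2 ^ ∑ m ∈ Finset.range n, m * (m + 1)
    have exponent_eq : (l⁻¹ • v) (Fin.last n) * ∑ j, (l • x) j = v (Fin.last n) * ∑ j, x j := by
      simp only [Pi.smul_apply, smul_eq_mul, ← Finset.mul_sum]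
      field_simp
    have dropLast_smul : dropLast (l⁻¹ • v) = l⁻¹ • dropLast v := by
      ext j
      simp [dropLast, mul_sub]
    rw [majorant, majorant, exponent_eq, dropLast_smul, mul_left_comm]
    gcongr ENNReal.ofReal _ * ?_
    calc ∫⁻ s, ENNReal.ofReal (stepDensity l x s) * majorant n l s (dropLast v)
        ≤ ∫⁻ s, ENNReal.ofReal (2 ^ (n * (n + 1)) * stepDensity 1 (l • x) (l • s)) *
            (ENNReal.ofReal c * majorant n 1 (l • s) (l⁻¹ • dropLast v)) := by
          gcongr with s
          · exact stepDensity_le_stepDensity_one hl x s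
          · exact ih s (dropLast v)
      _ = ENNReal.ofReal (2 ^ (n * (n + 1)) * c) *
            ∫⁻ s, ENNReal.ofReal (stepDensity 1 (l • x) (l • s)) *
              majorant n 1 (l • s) (l⁻¹ • dropLast v) := by
          rw [← lintegral_const_mul' _ _ ENNReal.ofReal_ne_top]
          refine lintegral_congr fun s => ?_
          rw [ENNReal.ofReal_mul (by positivity), ENNReal.ofReal_mul (by positivity),
            mul_mul_mul_comm]
      _ ≤ _ := by
          rw [Finset.sum_range_succ, pow_add, mul_comm c]
          gcongr ENNReal.ofReal _ * ?_
          exact lintegral_comp_smul_le volume hl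
            (measurable_majorant_integrand 1 (l • x) (l⁻¹ • dropLast v))

theorem majorant_ne_top {l : ℝ} (hl : 1 ≤ l) {x v : Fin n → ℝ} (hx : Function.Injective x)
    (hv : Function.Injective v) (hv2 : ∀ j k, |v j - v k| < 2 * l) : majorant n l x v ≠ ∞ := by
  have hl0 : 0 < l := by positivity
  have rescaled_eq := majorant_one_eq ((smul_right_injective ℝ hl0.ne').comp hx)
    ((smul_right_injective ℝ (inv_ne_zero hl0.ne')).comp hv) fun j k => by
      rw [Function.comp_apply, Function.comp_apply, ← smul_sub, smul_eq_mul, abs_mul,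
        abs_of_pos (inv_pos.2 hl0), inv_mul_lt_iff₀ hl0, mul_comm]
      exact hv2 j k
  exact ((majorant_le_majorant_one hl x v).trans_lt (ENNReal.mul_lt_top ENNReal.ofReal_lt_top
    (rescaled_eq.trans_lt ENNReal.ofReal_lt_top))).ne

theorem abs_cauchyKernel_le (y : Fin (n + 1) → ℝ) (s : Fin n → ℝ) :
    |cauchyKernel y s| ≤ (n + 1).factorial := by
  have entry_le (j k : Fin (n + 1)) :
      |bordered (fun (j : Fin (n + 1)) (k : Fin n) => Real.tanh (y j - s k)) j k| ≤ 1 := by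
    cases k using Fin.lastCases with
    | last => simp
    | cast k => simpa using (Real.abs_tanh_lt_one _).le
  calc |cauchyKernel y s| = (2 ^ n)⁻¹ *
        |(bordered fun (j : Fin (n + 1)) (k : Fin n) => Real.tanh (y j - s k)).det| := by
        simpa [abs_mul] using congrArg abs (cauchyKernel_eq_det y s 0)
    _ ≤ 1 * (n + 1).factorial := by
        gcongr
        · exact inv_le_one_of_one_le₀ (one_le_pow₀ one_le_two)
        · simpa using Matrix.det_le (abv := AbsoluteValue.abs) entry_le
    _ = _ := one_mul _

theorem abs_sinhProd_rpow_mul_stepDensity {l : ℝ} (hl : 0 ≤ l) (x : Fin (n + 1) → ℝ)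
    (s : Fin n → ℝ) :
    |sinhProd x| ^ l * stepDensity l x s = |cauchyKernel x s| ^ l * |sinhProd s| ^ l := by
  have := coshProd_pos x s
  rw [stepDensity, cauchyKernel, abs_div, abs_mul, abs_of_pos this,
    Real.div_rpow (by positivity) this.le, Real.mul_rpow (by positivity) (by positivity), two_mul,
    Real.rpow_add_of_nonneg (abs_nonneg _) hl hl]
  ring

theorem rpow_le_rpow_sub_mul {a c l l' : ℝ} (ha : 0 ≤ a) (hac : a ≤ c) (hl' : 0 ≤ l')
    (hl : l' ≤ l) : a ^ l ≤ c ^ (l - l') * a ^ l' :=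
  calc a ^ l = a ^ (l - l') * a ^ l' := by
        rw [← Real.rpow_add_of_nonneg ha (sub_nonneg.2 hl) hl', sub_add_cancel]
    _ ≤ c ^ (l - l') * a ^ l' := by gcongr

theorem stepDensity_mul_le_of_le {l l' c : ℝ} (hl' : 0 ≤ l') (hl : l' ≤ l) (hc : 0 ≤ c)
    (x : Fin (n + 1) → ℝ) {s : Fin n → ℝ} {a a' : ℝ≥0∞}
    (h : ENNReal.ofReal (|sinhProd s| ^ l) * a ≤
      ENNReal.ofReal (c ^ (l - l')) * (ENNReal.ofReal (|sinhProd s| ^ l') * a')) :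
    ENNReal.ofReal (|sinhProd x| ^ l * stepDensity l x s) * a ≤
      ENNReal.ofReal (((n + 1).factorial * c) ^ (l - l')) *
        (ENNReal.ofReal (|sinhProd x| ^ l' * stepDensity l' x s) * a') := by
  rw [abs_sinhProd_rpow_mul_stepDensity (hl'.trans hl), abs_sinhProd_rpow_mul_stepDensity hl',
    ENNReal.ofReal_mul (by positivity), ENNReal.ofReal_mul (by positivity), mul_assoc]
  calc _ ≤ ENNReal.ofReal ((n + 1).factorial ^ (l - l') * |cauchyKernel x s| ^ l') *
        (ENNReal.ofReal (c ^ (l - l')) * (ENNReal.ofReal (|sinhProd s| ^ l') * a')) := by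
        gcongr
        exact rpow_le_rpow_sub_mul (abs_nonneg _) (abs_cauchyKernel_le x s) hl' hl
    _ = _ := by
        rw [Real.mul_rpow (by positivity) hc, ENNReal.ofReal_mul (by positivity),
          ENNReal.ofReal_mul (by positivity)]
        ring

theorem abs_sinhProd_rpow_mul_majorant_le {l l' : ℝ} (hl' : 0 ≤ l') (hl : l' ≤ l)
    (x v : Fin n → ℝ) :
    ENNReal.ofReal (|sinhProd x| ^ l) * majorant n l x v ≤
      ENNReal.ofReal ((n.superFactorial : ℝ) ^ (l - l')) *
        (ENNReal.ofReal (|sinhProd x| ^ l') * majorant n l' x v) := by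
  induction n with
  | zero => simp [majorant, sinhProd]
  | succ n ih =>
    have mul_majorant_eq (m : ℝ) :
        ENNReal.ofReal (|sinhProd x| ^ m) * majorant (n + 1) m x v =
          ENNReal.ofReal (Real.exp (-(v (Fin.last n) * ∑ j, x j)) / n.factorial) *
            ∫⁻ s, ENNReal.ofReal (|sinhProd x| ^ m * stepDensity m x s) *
              majorant n m s (dropLast v) := by
      rw [majorant, mul_left_comm, ← lintegral_const_mul' _ _ ENNReal.ofReal_ne_top]
      congr 1
      refine lintegral_congr fun s => ?_
      rw [ENNReal.ofReal_mul (by positivity), mul_assoc]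
    rw [mul_majorant_eq, mul_majorant_eq, mul_left_comm]
    refine mul_le_mul_right (LE.le.trans_eq ?_ (lintegral_const_mul' _ _ ENNReal.ofReal_ne_top)) _
    refine lintegral_mono fun s => ?_
    rw [Nat.superFactorial_succ, Nat.cast_mul]
    exact stepDensity_mul_le_of_le hl' hl (Nat.cast_nonneg _) x (ih s (dropLast v))

theorem cosh_le_exp_mul_cosh {a b M : ℝ} (h : |a - b| ≤ M) :
    Real.cosh b ≤ Real.exp M * Real.cosh a := by
  obtain ⟨sub_ge, sub_le⟩ := abs_le.1 h
  have exp_le : Real.exp b ≤ Real.exp M * Real.exp a := by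
    rw [← Real.exp_add, Real.exp_le_exp]
    linarith
  have exp_neg_le : Real.exp (-b) ≤ Real.exp M * Real.exp (-a) := by
    rw [← Real.exp_add, Real.exp_le_exp]
    linarith
  rw [Real.cosh_eq, Real.cosh_eq]
  linarith

theorem coshProd_le_of_abs_sub_le {x z : Fin (n + 1) → ℝ} {M : ℝ} (h : ∀ j, |x j - z j| ≤ M)
    (s : Fin n → ℝ) : coshProd z s ≤ Real.exp M ^ (n * (n + 1)) * coshProd x s :=
  calc coshProd z s ≤ ∏ j, ∏ k, Real.exp M * (2 * Real.cosh (x j - s k)) := by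
        unfold coshProd
        gcongr ∏ j, ∏ k, ?_ with j _ k
        have := cosh_le_exp_mul_cosh (a := x j - s k) (b := z j - s k) (by simpa using h j)
        linarith
    _ = Real.exp M ^ (n * (n + 1)) * coshProd x s := by
        simp [coshProd, Finset.prod_mul_distrib, pow_mul]

theorem one_le_superFactorial (n : ℕ) : 1 ≤ n.superFactorial := by
  rw [← Nat.prod_range_factorial_succ]
  exact Finset.prod_pos fun k _ => Nat.factorial_pos (k + 1)

theorem stepDensity_mul_majorant_le_of_le {z : Fin (n + 1) → ℝ} (hz : 1 ≤ |sinhProd z|)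
    {l l' : ℝ} (hl' : 0 ≤ l') (hl : l' ≤ l) (s v : Fin n → ℝ) :
    ENNReal.ofReal (stepDensity l z s) * majorant n l s v ≤
      ENNReal.ofReal ((n + 1).superFactorial ^ (l - l')) *
        (ENNReal.ofReal (stepDensity l' z s) * majorant n l' s v) := by
  have hz0 : 0 < |sinhProd z| := one_pos.trans_le hz
  refine (ENNReal.mul_le_mul_iff_right (ENNReal.ofReal_pos.2 (Real.rpow_pos_of_pos hz0 l')).ne'
    ENNReal.ofReal_ne_top).1 ?_
  calc ENNReal.ofReal (|sinhProd z| ^ l') * (ENNReal.ofReal (stepDensity l z s) * majorant n l s v)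
      ≤ ENNReal.ofReal (|sinhProd z| ^ l * stepDensity l z s) * majorant n l s v := by
        rw [ENNReal.ofReal_mul (by positivity), mul_assoc]
        gcongr
    _ ≤ ENNReal.ofReal (((n + 1).factorial * n.superFactorial : ℝ) ^ (l - l')) *
          (ENNReal.ofReal (|sinhProd z| ^ l' * stepDensity l' z s) * majorant n l' s v) :=
        stepDensity_mul_le_of_le hl' hl (Nat.cast_nonneg _) z
          (abs_sinhProd_rpow_mul_majorant_le hl' hl s v)
    _ = _ := by
        rw [ENNReal.ofReal_mul (by positivity), Nat.superFactorial_succ, Nat.cast_mul]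
        ring

theorem stepDensity_mul_majorant_le {z : Fin (n + 1) → ℝ} (hz : 1 ≤ |sinhProd z|)
    {x : Fin (n + 1) → ℝ} {M : ℝ} (hx : ∀ j, |x j - z j| ≤ M) {l l' L : ℝ} (hl' : 0 ≤ l')
    (hl : l' ≤ l) (hL : l ≤ L) (s v : Fin n → ℝ) :
    ENNReal.ofReal (stepDensity l x s) * majorant n l s v ≤
      ENNReal.ofReal ((Real.exp M ^ (n * (n + 1)) * (n + 1).superFactorial) ^ L) *
        (ENNReal.ofReal (stepDensity l' z s) * majorant n l' s v) := by
  have hM : 0 ≤ M := (abs_nonneg _).trans (hx 0)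
  have := coshProd_pos x s
  have := coshProd_pos z s
  set D := Real.exp M ^ (n * (n + 1))
  have one_le_D : 1 ≤ D := one_le_pow₀ (Real.one_le_exp hM)
  have one_le_sf : (1 : ℝ) ≤ (n + 1).superFactorial := mod_cast one_le_superFactorial _
  have stepDensity_le : stepDensity l x s ≤ D ^ L * stepDensity l z s :=
    calc stepDensity l x s ≤ |sinhProd s| ^ (2 * l) / (D⁻¹ * coshProd z s) ^ l := by
          unfold stepDensity
          gcongr
          · exact hl'.trans hl
          · rw [inv_mul_le_iff₀ (by positivity)]
            exact coshProd_le_of_abs_sub_le hx s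
      _ = D ^ l * stepDensity l z s := by
          rw [stepDensity, Real.mul_rpow (by positivity) (by positivity),
            Real.inv_rpow (by positivity)]
          field_simp
      _ ≤ D ^ L * stepDensity l z s := by
          have := stepDensity_nonneg l z s
          gcongr
  calc _ ≤ ENNReal.ofReal (D ^ L) * (ENNReal.ofReal (stepDensity l z s) * majorant n l s v) := by
        rw [← mul_assoc, ← ENNReal.ofReal_mul (by positivity)]
        gcongr
    _ ≤ ENNReal.ofReal (D ^ L) * (ENNReal.ofReal ((n + 1).superFactorial ^ L) *
          (ENNReal.ofReal (stepDensity l' z s) * majorant n l' s v)) := by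
        refine mul_le_mul_right ((stepDensity_mul_majorant_le_of_le hz hl' hl s v).trans ?_) _
        gcongr
        linarith
    _ = _ := by
        rw [← mul_assoc, ← ENNReal.ofReal_mul (by positivity),
          ← Real.mul_rpow (by positivity) (by positivity)]

theorem one_le_abs_sinhProd_natCast (n : ℕ) : 1 ≤ |sinhProd fun j : Fin n => (j : ℝ)| :=
  calc (1 : ℝ) = ∏ j : Fin n, ∏ _k ∈ Finset.Ioi j, 1 := by simp
    _ ≤ ∏ j : Fin n, ∏ k ∈ Finset.Ioi j, |2 * Real.sinh ((j : ℝ) - k)| := by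
        gcongr with j _ k hjk
        have one_le_sub : (1 : ℝ) ≤ k - j := by
          rw [le_sub_iff_add_le']
          exact_mod_cast Fin.lt_def.1 (Finset.mem_Ioi.1 hjk)
        have sub_le_sinh := Real.self_le_sinh_iff.2 (zero_le_one.trans one_le_sub)
        rw [abs_mul, Real.abs_sinh, abs_sub_comm, abs_of_nonneg (zero_le_one.trans one_le_sub),
          abs_two]
        linarith
    _ = _ := by simp only [sinhProd, Finset.abs_prod]

/-! ### Translation covariance -/

/-- Real variables regarded as complex ones. -/
def ofRealVec (s : Fin n → ℝ) : Fin n → ℂ := fun j => (s j : ℂ)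

theorem contour_zero (s : Fin n → ℝ) : contour 0 s = ofRealVec s := by
  ext j
  simp [contour, ofRealVec]

theorem weight_add_const (lam : ℂ) (s : Fin n → ℂ) (c : ℂ) :
    weight lam (fun j => s j + c) = weight lam s := by
  simp [weight]

theorem kernel_add_const (lam : ℂ) (t : Fin (n + 1) → ℂ) (s : Fin n → ℂ) (c : ℂ) :
    kernel lam (fun j => t j + c) (fun j => s j + c) = kernel lam t s := by
  simp [kernel]

theorem midHeight_add_const (t : Fin (n + 1) → ℂ) (c : ℂ) :
    midHeight (fun j => t j + c) = midHeight t + c.im := by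
  have iSup_add := ciSup_add (Set.finite_range fun j => (t j).im).bddAbove c.im
  have iInf_add := ciInf_add (Set.finite_range fun j => (t j).im).bddBelow c.im
  simp only [midHeight, Complex.add_im]
  rw [← iSup_add, ← iInf_add]
  ring

theorem stepIntegrand_add_const {G : (Fin n → ℂ) → (Fin n → ℂ) → ℂ}
    (hG : ∀ s u c, G (fun j => s j + c) u = Complex.exp (Complex.I * c * ∑ j, u j) * G s u)
    (lam : ℂ) (t u : Fin (n + 1) → ℂ) (m : ℝ) (c : ℂ) (s : Fin n → ℝ) :
    stepIntegrand G lam (fun j => t j + c) u (m + c.im) (fun j => s j + c.re) =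
      Complex.exp (Complex.I * c * ∑ j, dropLast u j) * stepIntegrand G lam t u m s := by
  have contour_add : contour (m + c.im) (fun j => s j + c.re) = fun j => contour m s j + c := by
    ext j
    apply Complex.ext <;> simp [contour]
  rw [stepIntegrand, contour_add, weight_add_const, kernel_add_const, hG, stepIntegrand]
  simp only [dropLast]
  ring

theorem F_add_const (lam : ℂ) (t u : Fin n → ℂ) (c : ℂ) :
    F n lam (fun j => t j + c) u = Complex.exp (Complex.I * c * ∑ j, u j) * F n lam t u := by
  induction n generalizing c with
  | zero => simp [F]
  | succ n ih =>
    have integral_eq : ∫ s, stepIntegrand (F n lam) lam (fun j => t j + c) u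
        (midHeight fun j => t j + c) s = Complex.exp (Complex.I * c * ∑ j, dropLast u j) *
          ∫ s, stepIntegrand (F n lam) lam t u (midHeight t) s := by
      rw [midHeight_add_const, ← integral_add_right_eq_self _ (fun _ : Fin n => c.re),
        ← integral_const_mul]
      exact integral_congr_ae (.of_forall fun s => stepIntegrand_add_const
        (fun s u c => ih s u c) lam t u (midHeight t) c s)
    have exp_eq : Complex.exp (Complex.I * u (Fin.last n) * ∑ j, (t j + c)) *
        Complex.exp (Complex.I * c * ∑ j, dropLast u j) =
        Complex.exp (Complex.I * c * ∑ j, u j) *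
          Complex.exp (Complex.I * u (Fin.last n) * ∑ j, t j) := by
      rw [← Complex.exp_add, ← Complex.exp_add]
      congr 1
      simp only [dropLast, Finset.sum_add_distrib, Finset.sum_sub_distrib, Fin.sum_univ_castSucc u,
        Finset.sum_const, Finset.card_univ, Fintype.card_fin, nsmul_eq_mul]
      push_cast
      ring
    rw [F, F, integral_eq, ← mul_assoc, div_mul_eq_mul_div, exp_eq]
    ring

theorem stepIntegrand_eq_stepIntegrand_zero (lam : ℂ) (t u : Fin (n + 1) → ℂ) (c : ℝ)
    (s : Fin n → ℝ) :
    stepIntegrand (F n lam) lam t u c s = Complex.exp (Complex.I * (Complex.I * c) *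
      ∑ j, dropLast u j) * stepIntegrand (F n lam) lam (fun j => t j - Complex.I * c) u 0 s := by
  have := stepIntegrand_add_const (fun s u c => F_add_const lam s u c) lam
    (fun j => t j - Complex.I * c) u 0 (Complex.I * c) s
  simpa using this

/-! ### Bounds on the integrand -/

theorem norm_weight_ofRealVec {lam : ℂ} (hl : lam.re ≠ 0) (s : Fin n → ℝ) :
    ‖weight lam (ofRealVec s)‖ = |sinhProd s| ^ (2 * lam.re) := by
  have norm_factor (j k : Fin n) :
      ‖(4 * Complex.sinh (ofRealVec s j - ofRealVec s k) ^ 2) ^ lam‖ =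
        |2 * Real.sinh (s j - s k)| ^ (2 * lam.re) := by
    have base_eq : 4 * Complex.sinh (ofRealVec s j - ofRealVec s k) ^ 2 =
        (((2 * Real.sinh (s j - s k)) ^ 2 : ℝ) : ℂ) := by
      simp only [ofRealVec]
      push_cast
      ring
    rw [base_eq, Complex.norm_cpow_eq_rpow_re_of_nonneg (sq_nonneg _) hl,
      Real.rpow_mul (abs_nonneg _), Real.rpow_two, sq_abs]
  have prod_rpow (j : Fin n) :=
    Real.finsetProd_rpow (Finset.Ioi j) (fun k => |2 * Real.sinh (s j - s k)|)
      (fun _ _ => abs_nonneg _) (2 * lam.re)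
  simp_rw [weight, norm_prod, norm_factor, prod_rpow]
  rw [Real.finsetProd_rpow _ _ fun _ _ => by positivity]
  simp only [sinhProd, Finset.abs_prod]

theorem coshProd_rpow_inv (x : Fin (n + 1) → ℝ) (s : Fin n → ℝ) (l : ℝ) :
    (coshProd x s ^ l)⁻¹ = ∏ j, ∏ k, (2 * Real.cosh (x j - s k)) ^ (-l) := by
  have prod_rpow (j : Fin (n + 1)) :=
    Real.finsetProd_rpow Finset.univ (fun k => 2 * Real.cosh (x j - s k))
      (fun _ _ => by positivity) (-l)
  simp_rw [prod_rpow]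
  rw [Real.finsetProd_rpow _ _ fun _ _ => by positivity, ← Real.rpow_neg (coshProd_pos x s).le,
    coshProd]

theorem norm_kernel_ofRealVec (lam : ℂ) (x : Fin (n + 1) → ℝ) (s : Fin n → ℝ) :
    ‖kernel lam (ofRealVec x) (ofRealVec s)‖ = (coshProd x s ^ lam.re)⁻¹ := by
  simp_rw [coshProd_rpow_inv, kernel, norm_prod]
  refine Finset.prod_congr rfl fun j _ => Finset.prod_congr rfl fun k _ => ?_
  have base_eq : 2 * Complex.cosh (ofRealVec x j - ofRealVec s k) =
      ((2 * Real.cosh (x j - s k) : ℝ) : ℂ) := by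
    simp [ofRealVec]
  rw [base_eq, Complex.norm_cpow_eq_rpow_re_of_pos (by positivity), Complex.neg_re]

theorem re_cosh (z : ℂ) : (Complex.cosh z).re = Real.cosh z.re * Real.cos z.im := by
  conv_lhs => rw [← Complex.re_add_im z, Complex.cosh_add]
  simp [Complex.cosh_mul_I, Complex.sinh_mul_I, ← Complex.ofReal_cosh, ← Complex.ofReal_cos,
    ← Complex.ofReal_sinh, ← Complex.ofReal_sin]

theorem cos_mul_cosh_le_re_cosh {z : ℂ} {μ : ℝ} (hz : |z.im| ≤ μ) (hμ : μ ≤ Real.pi) :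
    Real.cos μ * Real.cosh z.re ≤ (Complex.cosh z).re := by
  rw [re_cosh, mul_comm, ← Real.cos_abs z.im]
  gcongr
  exact Real.cos_le_cos_of_nonneg_of_le_pi (abs_nonneg _) hμ hz

theorem norm_two_mul_cosh_cpow_le {lam z : ℂ} {μ : ℝ} (hl : 0 ≤ lam.re) (hz : |z.im| ≤ μ)
    (hμ : μ < Real.pi / 2) :
    ‖(2 * Complex.cosh z) ^ (-lam)‖ ≤
      Real.exp (Real.pi * |lam.im|) * Real.cos μ ^ (-lam.re) *
        (2 * Real.cosh z.re) ^ (-lam.re) := by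
  have cos_pos : 0 < Real.cos μ :=
    Real.cos_pos_of_mem_Ioo ⟨by linarith [(abs_nonneg _).trans hz], hμ⟩
  have le_norm : Real.cos μ * (2 * Real.cosh z.re) ≤ ‖2 * Complex.cosh z‖ :=
    calc Real.cos μ * (2 * Real.cosh z.re) ≤ 2 * (Complex.cosh z).re := by
          linarith [cos_mul_cosh_le_re_cosh hz (by linarith [Real.pi_pos])]
      _ = (2 * Complex.cosh z).re := by simp
      _ ≤ ‖2 * Complex.cosh z‖ := Complex.re_le_norm _
  have lower_pos : 0 < Real.cos μ * (2 * Real.cosh z.re) := by positivity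
  rw [Complex.norm_cpow_of_ne_zero (norm_pos_iff.1 (lower_pos.trans_le le_norm)), mul_assoc,
    ← Real.mul_rpow cos_pos.le (by positivity), div_eq_inv_mul, ← Real.exp_neg, Complex.neg_re]
  refine mul_le_mul (Real.exp_le_exp.2 ?_)
    (Real.rpow_le_rpow_of_nonpos lower_pos le_norm (neg_nonpos.2 hl)) (by positivity)
    (Real.exp_pos _).le
  calc _ ≤ |-(Complex.arg (2 * Complex.cosh z) * (-lam).im)| := le_abs_self _
    _ = |Complex.arg (2 * Complex.cosh z)| * |lam.im| := by simp [abs_mul]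
    _ ≤ Real.pi * |lam.im| := by
      gcongr
      exact Complex.abs_arg_le_pi _

/-- A bound for the ratio of `kernel` to its value at the real parts of its arguments, for
imaginary parts of at most `μ`. -/
def kernelFactor (n : ℕ) (lam : ℂ) (μ : ℝ) : ℝ :=
  (Real.exp (Real.pi * |lam.im|) * Real.cos μ ^ (-lam.re)) ^ (n * (n + 1))

theorem kernelFactor_nonneg (n : ℕ) (lam : ℂ) {μ : ℝ} (hμ0 : 0 ≤ μ) (hμ : μ < Real.pi / 2) :
    0 ≤ kernelFactor n lam μ := by
  have := Real.cos_nonneg_of_neg_pi_div_two_le_of_le (by linarith) hμ.le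
  unfold kernelFactor
  positivity

theorem norm_kernel_le {lam : ℂ} {μ : ℝ} (hl : 0 ≤ lam.re) {t : Fin (n + 1) → ℂ}
    (ht : ∀ j, |(t j).im| ≤ μ) (hμ : μ < Real.pi / 2) (s : Fin n → ℝ) :
    ‖kernel lam t (ofRealVec s)‖ ≤
      kernelFactor n lam μ * (coshProd (fun j => (t j).re) s ^ lam.re)⁻¹ :=
  calc ‖kernel lam t (ofRealVec s)‖
      ≤ ∏ j, ∏ k, Real.exp (Real.pi * |lam.im|) * Real.cos μ ^ (-lam.re) *
          (2 * Real.cosh ((t j).re - s k)) ^ (-lam.re) := by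
        simp_rw [kernel, norm_prod]
        gcongr with j _ k
        simpa [ofRealVec] using norm_two_mul_cosh_cpow_le (z := t j - ofRealVec s k) hl
          (by simpa [ofRealVec] using ht j) hμ
    _ = _ := by
        rw [coshProd_rpow_inv]
        simp_rw [Finset.prod_mul_distrib]
        simp [kernelFactor, pow_mul, mul_pow]

theorem stepIntegrand_zero (G : (Fin n → ℂ) → (Fin n → ℂ) → ℂ) (lam : ℂ)
    (t u : Fin (n + 1) → ℂ) (s : Fin n → ℝ) :
    stepIntegrand G lam t u 0 s =
      weight lam (ofRealVec s) * kernel lam t (ofRealVec s) * G (ofRealVec s) (dropLast u) := by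
  rw [stepIntegrand, contour_zero]
  rfl

theorem midHeight_ofRealVec (x : Fin n → ℝ) : midHeight (ofRealVec x) = 0 := by
  simp [midHeight, ofRealVec]

theorem dropLast_im (u : Fin (n + 1) → ℂ) :
    (fun j => (dropLast u j).im) = dropLast fun j => (u j).im := by
  ext j
  simp [dropLast]

theorem enorm_F_ofRealVec_le {lam : ℂ} (hl : lam.re ≠ 0) (x : Fin n → ℝ) (u : Fin n → ℂ) :
    ‖F n lam (ofRealVec x) u‖ₑ ≤ majorant n lam.re x fun j => (u j).im := by
  induction n with
  | zero => simp [F, majorant]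
  | succ n ih =>
    rw [F, majorant, midHeight_ofRealVec, enorm_mul]
    refine mul_le_mul' (le_of_eq ?_)
      ((enorm_integral_le_lintegral_enorm _).trans (lintegral_mono fun s => ?_))
    · rw [← ofReal_norm, norm_div, Complex.norm_exp, Complex.norm_natCast]
      simp [ofRealVec, ← Complex.ofReal_sum]
    · rw [stepIntegrand_zero, enorm_mul, ← ofReal_norm (weight _ _ * _), norm_mul,
        norm_weight_ofRealVec hl, norm_kernel_ofRealVec, ← div_eq_mul_inv, ← dropLast_im]
      exact mul_le_mul_right (ih s _) _

theorem enorm_stepIntegrand_le {lam : ℂ} {μ : ℝ} (hl : 0 < lam.re) {t : Fin (n + 1) → ℂ}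
    (ht : ∀ j, |(t j).im| ≤ μ) (hμ : μ < Real.pi / 2) (u : Fin (n + 1) → ℂ) (s : Fin n → ℝ) :
    ‖stepIntegrand (F n lam) lam t u 0 s‖ₑ ≤ ENNReal.ofReal (kernelFactor n lam μ) *
      (ENNReal.ofReal (stepDensity lam.re (fun j => (t j).re) s) *
        majorant n lam.re s (dropLast fun j => (u j).im)) := by
  have factor_nonneg := kernelFactor_nonneg n lam ((abs_nonneg _).trans (ht 0)) hμ
  rw [stepIntegrand_zero, enorm_mul, ← mul_assoc, ← ENNReal.ofReal_mul factor_nonneg,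
    ← dropLast_im, ← ofReal_norm (weight _ _ * _), norm_mul, norm_weight_ofRealVec hl.ne']
  refine mul_le_mul' (ENNReal.ofReal_le_ofReal ?_) (enorm_F_ofRealVec_le hl.ne' s _)
  calc _ ≤ |sinhProd s| ^ (2 * lam.re) *
        (kernelFactor n lam μ * (coshProd (fun j => (t j).re) s ^ lam.re)⁻¹) :=
        mul_le_mul_of_nonneg_left (norm_kernel_le hl.le ht hμ s) (by positivity)
    _ = _ := by
        rw [stepDensity]
        ring

/-! ### Convexity in the spectral parameters -/

theorem ofReal_exp_mul_majorant_succ (l c : ℝ) (x v : Fin (n + 1) → ℝ) :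
    ENNReal.ofReal (Real.exp c) * majorant (n + 1) l x v =
      ENNReal.ofReal (n.factorial : ℝ)⁻¹ * ∫⁻ s, ENNReal.ofReal (stepDensity l x s) *
        (ENNReal.ofReal (Real.exp (c - v (Fin.last n) * ∑ j, x j)) *
          majorant n l s (dropLast v)) := by
  simp_rw [mul_left_comm (ENNReal.ofReal (stepDensity l x _))]
  rw [majorant, lintegral_const_mul' _ _ ENNReal.ofReal_ne_top, ← mul_assoc, ← mul_assoc,
    ← ENNReal.ofReal_mul (by positivity), ← ENNReal.ofReal_mul (by positivity), ← mul_div_assoc,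
    ← Real.exp_add, ← sub_eq_add_neg, div_eq_inv_mul]

theorem exp_sum_mul_le {ι : Type*} {I : Finset ι} {a : ι → ℝ} (ha : ∀ i ∈ I, 0 ≤ a i)
    (ha1 : ∑ i ∈ I, a i = 1) (b : ι → ℝ) :
    Real.exp (∑ i ∈ I, a i * b i) ≤ ∑ i ∈ I, Real.exp (b i) :=
  calc Real.exp (∑ i ∈ I, a i * b i) ≤ ∑ i ∈ I, a i * Real.exp (b i) :=
        convexOn_exp.map_sum_le ha ha1 fun _ _ => Set.mem_univ _
    _ ≤ ∑ i ∈ I, Real.exp (b i) := by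
        refine Finset.sum_le_sum fun i hi => mul_le_of_le_one_left (Real.exp_pos _).le ?_
        exact ha1 ▸ Finset.single_le_sum ha hi

theorem majorant_sum_smul_le {ι : Type*} {I : Finset ι} {a : ι → ℝ} (ha : ∀ i ∈ I, 0 ≤ a i)
    (ha1 : ∑ i ∈ I, a i = 1) (b : ι → ℝ) (l : ℝ) (x : Fin n → ℝ) (w : ι → Fin n → ℝ) :
    ENNReal.ofReal (Real.exp (∑ i ∈ I, a i * b i)) * majorant n l x (∑ i ∈ I, a i • w i) ≤
      ∑ i ∈ I, ENNReal.ofReal (Real.exp (b i)) * majorant n l x (w i) := by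
  induction n generalizing b with
  | zero =>
    simp only [majorant, mul_one]
    rw [← ENNReal.ofReal_sum_of_nonneg fun _ _ => (Real.exp_pos _).le]
    exact ENNReal.ofReal_le_ofReal (exp_sum_mul_le ha ha1 b)
  | succ n ih =>
    have measurable_summand (i : ι) : Measurable fun s =>
        ENNReal.ofReal (stepDensity l x s) *
          (ENNReal.ofReal (Real.exp (b i - w i (Fin.last n) * ∑ j, x j)) *
            majorant n l s (dropLast (w i))) := by
      simp_rw [mul_left_comm (ENNReal.ofReal (stepDensity l x _))]
      exact (measurable_majorant_integrand l x _).const_mul _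
    simp_rw [ofReal_exp_mul_majorant_succ, ← Finset.mul_sum]
    rw [← lintegral_finsetSum _ fun i _ => measurable_summand i]
    refine mul_le_mul_right (lintegral_mono fun s => ?_) _
    rw [← Finset.mul_sum]
    refine mul_le_mul_right ?_ _
    convert ih (fun i => b i - w i (Fin.last n) * ∑ j, x j) s (fun i => dropLast (w i)) using 4
    · simp only [Finset.sum_apply, Pi.smul_apply, smul_eq_mul, mul_sub, Finset.sum_sub_distrib,
        Finset.sum_mul, mul_assoc]
    · ext j
      simp [dropLast, mul_sub, Finset.sum_sub_distrib]

theorem majorant_dropLast_le_sum {V : Finset (Fin (n + 1) → ℝ)} {v : Fin (n + 1) → ℝ}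
    (hv : v ∈ convexHull ℝ (V : Set (Fin (n + 1) → ℝ))) (l : ℝ) (s : Fin n → ℝ) :
    majorant n l s (dropLast v) ≤ ∑ w ∈ V, majorant n l s (dropLast w) := by
  obtain ⟨a, ha, ha1, rfl⟩ := Finset.mem_convexHull'.1 hv
  have dropLast_sum : dropLast (∑ w ∈ V, a w • w) = ∑ w ∈ V, a w • dropLast w := by
    ext j
    simp [dropLast, mul_sub, Finset.sum_sub_distrib]
  simpa [dropLast_sum] using majorant_sum_smul_le ha ha1 0 l s dropLast

/-! ### Domination of the integrand -/

open scoped Pointwise in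
theorem exists_finset_convexHull_mem_nhds {E : Type*} [NormedAddCommGroup E] [NormedSpace ℝ E]
    [FiniteDimensional ℝ E] [MeasurableSpace E] [BorelSpace E] {μ : Measure E}
    [μ.IsAddHaarMeasure] {P : E → Prop} (hP : ∀ᵐ w ∂μ, P w) {x : E} {s : Set E} (hs : s ∈ 𝓝 x) :
    ∃ V : Finset E, (∀ w ∈ V, P w ∧ w ∈ s) ∧ convexHull ℝ (V : Set E) ∈ 𝓝 x := by
  classical
  obtain ⟨b, hxb, hbs⟩ := exists_mem_interior_convexHull_affineBasis (interior_mem_nhds.2 hs)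
  have translate_mem : ∀ᶠ c in 𝓝 (0 : E), ∀ i, b i + c ∈ s := by
    refine eventually_all.2 fun i => ?_
    have hi : s ∈ 𝓝 (b i + 0) := by
      rw [add_zero]
      exact mem_interior_iff_mem_nhds.1 (hbs (subset_convexHull ℝ _ (Set.mem_range_self i)))
    exact (continuous_const_add (b i)).continuousAt.eventually_mem hi
  have sub_mem : ∀ᶠ c in 𝓝 (0 : E), x - c ∈ interior (convexHull ℝ (Set.range b)) :=
    (continuous_const.sub continuous_id).continuousAt.eventually_mem
      (by simpa using isOpen_interior.mem_nhds hxb)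
  have generic : ∀ᵐ c ∂μ, ∀ i, P (b i + c) :=
    ae_all_iff.2 fun i => (eventually_add_left_iff μ (b i)).2 hP
  obtain ⟨c, hPc, hcs, hxc⟩ := (mem_closure_iff_frequently.1
    (Measure.dense_of_ae generic 0)).and_eventually (translate_mem.and sub_mem) |>.exists
  refine ⟨Finset.univ.image fun i => b i + c, by simpa using fun i => ⟨hPc i, hcs i⟩, ?_⟩
  have image_eq : ((Finset.univ.image fun i => b i + c : Finset E) : Set E) =
      c +ᵥ Set.range b := by
    ext w
    simp [Set.mem_vadd_set, add_comm]
  rw [image_eq, convexHull_vadd]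
  have := vadd_mem_nhds_vadd c (mem_interior_iff_mem_nhds.1 hxc)
  simpa using this

theorem continuousOn_kernelFactor (n : ℕ) :
    ContinuousOn (fun q : ℂ × ℝ => kernelFactor n q.1 q.2)
      (Set.univ ×ˢ Set.Ico 0 (Real.pi / 2)) := by
  unfold kernelFactor
  refine ContinuousOn.pow (ContinuousOn.mul (by fun_prop) ?_) _
  refine ContinuousOn.rpow (by fun_prop) (by fun_prop) fun q hq => Or.inl ?_
  exact (Real.cos_pos_of_mem_Ioo ⟨by linarith [hq.2.1, Real.pi_pos], hq.2.2⟩).ne'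

theorem lintegral_stepDensity_mul_majorant_ne_top {l : ℝ} (hl : 1 ≤ l) {x v : Fin (n + 1) → ℝ}
    (hx : Function.Injective x) (hv : Function.Injective v) (hv2 : ∀ j k, |v j - v k| < 2 * l) :
    ∫⁻ s, ENNReal.ofReal (stepDensity l x s) * majorant n l s (dropLast v) ≠ ∞ := by
  intro integral_eq_top
  refine majorant_ne_top hl hx hv hv2 ?_
  rw [majorant, integral_eq_top, ENNReal.mul_top (ENNReal.ofReal_pos.2 (by positivity)).ne']

theorem enorm_stepIntegrand_le_sum {lam : ℂ} {t u : Fin (n + 1) → ℂ} {l L μ M C : ℝ}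
    {V : Finset (Fin (n + 1) → ℝ)} (hl : 0 < l) (hlam : l ≤ lam.re) (hL : lam.re ≤ L)
    (ht_im : ∀ j, |(t j).im| ≤ μ) (hμ : μ < Real.pi / 2) (ht_re : ∀ j, |(t j).re - j| ≤ M)
    (hu : (fun j => (u j).im) ∈ convexHull ℝ (V : Set (Fin (n + 1) → ℝ)))
    (hC : kernelFactor n lam μ ≤ C) (s : Fin n → ℝ) :
    ‖stepIntegrand (F n lam) lam t u 0 s‖ₑ ≤ ENNReal.ofReal C *
      (ENNReal.ofReal ((Real.exp M ^ (n * (n + 1)) * (n + 1).superFactorial) ^ L) *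
        ∑ w ∈ V, ENNReal.ofReal (stepDensity l (fun j => (j : ℝ)) s) *
          majorant n l s (dropLast w)) := by
  refine (enorm_stepIntegrand_le (hl.trans_le hlam) ht_im hμ u s).trans
    (mul_le_mul' (ENNReal.ofReal_le_ofReal hC) ?_)
  refine (stepDensity_mul_majorant_le (one_le_abs_sinhProd_natCast (n + 1)) ht_re hl.le hlam hL s
    _).trans (mul_le_mul_right ?_ _)
  rw [← Finset.mul_sum]
  exact mul_le_mul_right (majorant_dropLast_le_sum hu l s) _

/-- The arguments `(lam, t, u)` of `F N`, bundled as in `extDomain N`. -/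
abbrev Params (N : ℕ) : Type := ℂ × (Fin N → ℂ) × (Fin N → ℂ)

/-- The integrand of the recursion step over the real contour. -/
def realIntegrand (p : Params (n + 1)) (s : Fin n → ℝ) : ℂ :=
  stepIntegrand (F n p.1) p.1 p.2.1 p.2.2 0 s

/-- The parameters for which the recursion step may be taken over the real contour. -/
def realContourDomain (n : ℕ) : Set (Params (n + 1)) :=
  {p | 1 ≤ p.1.re ∧ (∀ j, |(p.2.1 j).im| < Real.pi / 2) ∧
    ∀ j k, |(p.2.2 j - p.2.2 k).im| < 2 * p.1.re}

-- The coupling `l = 1` has no room below it, whence the restriction to `Set.Ici 1`.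
theorem exists_lt_two_mul_eventually_le {ι : Type*} [Finite ι] {l : ℝ} (hl : 1 ≤ l) {d : ι → ℝ}
    (hd : ∀ i, d i < 2 * l) :
    ∃ l', 1 ≤ l' ∧ (∀ i, d i < 2 * l') ∧ ∀ᶠ m in 𝓝[Set.Ici 1] l, l' ≤ m := by
  rcases hl.eq_or_lt with rfl | hl
  · exact ⟨1, le_rfl, hd, self_mem_nhdsWithin⟩
  · have two_mul_lt : ∀ᶠ l' in 𝓝 l, ∀ i, d i < 2 * l' := eventually_all.2 fun i =>
      (Continuous.tendsto (by fun_prop) l).eventually_const_lt (hd i)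
    obtain ⟨l', ⟨h_one, h_two⟩, h_lt⟩ := (((eventually_gt_nhds hl).and two_mul_lt).filter_mono
      (nhdsWithin_le_nhds (s := Set.Iio l))).and self_mem_nhdsWithin |>.exists
    exact ⟨l', h_one.le, h_two, mem_nhdsWithin_of_mem_nhds (eventually_ge_nhds h_lt)⟩

theorem exists_generic_vertices {l : ℝ} (hl : 1 ≤ l) {v : Fin n → ℝ}
    (hv : ∀ j k, |v j - v k| < 2 * l) :
    ∃ l', 1 ≤ l' ∧ (∀ᶠ m in 𝓝[Set.Ici 1] l, l' ≤ m) ∧ ∃ V : Finset (Fin n → ℝ),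
      (∀ w ∈ V, Function.Injective w ∧ ∀ j k, |w j - w k| < 2 * l') ∧
        convexHull ℝ (V : Set (Fin n → ℝ)) ∈ 𝓝 v := by
  obtain ⟨l', hl', hv', le_of_near⟩ := exists_lt_two_mul_eventually_le hl
    (d := fun i : Fin n × Fin n => |v i.1 - v i.2|) fun i => hv _ _
  refine ⟨l', hl', le_of_near, exists_finset_convexHull_mem_nhds (ae_injective (Fin n))
    (s := {w | ∀ j k, |w j - w k| < 2 * l'}) ?_⟩
  exact eventually_all.2 fun j => eventually_all.2 fun k =>
    (Continuous.tendsto (by fun_prop) v).eventually_lt_const (hv' (j, k))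

theorem exists_uniform_bounds {p₀ : Params (n + 1)} (hp₀ : p₀ ∈ realContourDomain n) :
    ∃ (l L μ M C : ℝ) (V : Finset (Fin (n + 1) → ℝ)), 1 ≤ l ∧ μ < Real.pi / 2 ∧
      (∀ w ∈ V, Function.Injective w ∧ ∀ j k, |w j - w k| < 2 * l) ∧
      ∀ᶠ p in 𝓝[realContourDomain n] p₀, l ≤ p.1.re ∧ p.1.re ≤ L ∧
        (∀ j, |(p.2.1 j).im| ≤ μ) ∧ (∀ j : Fin (n + 1), |(p.2.1 j).re - (j : ℝ)| ≤ M) ∧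
        (fun j => (p.2.2 j).im) ∈ convexHull ℝ (V : Set (Fin (n + 1) → ℝ)) ∧
        kernelFactor n p.1 μ ≤ C := by
  obtain ⟨hlam, ht, hu⟩ := hp₀
  obtain ⟨l, hl, l_le, V, hV, hull_mem⟩ := exists_generic_vertices hlam
    (v := fun j => (p₀.2.2 j).im) fun j k => by simpa using hu j k
  obtain ⟨μ, hμ, hμ'⟩ : ∃ μ, ‖fun j => (p₀.2.1 j).im‖ < μ ∧ μ < Real.pi / 2 :=
    exists_between ((pi_norm_lt_iff (by positivity)).2 ht)
  have continuous_factor : Continuous fun p : Params (n + 1) => kernelFactor n p.1 μ :=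
    (continuousOn_kernelFactor n).comp_continuous
      (by fun_prop : Continuous fun p : Params (n + 1) => (p.1, μ))
      fun p => ⟨Set.mem_univ _, (norm_nonneg _).trans hμ.le, hμ'⟩
  set offset : Params (n + 1) → Fin (n + 1) → ℝ := fun p j => (p.2.1 j).re - j
  refine ⟨l, p₀.1.re + 1, μ, ‖offset p₀‖ + 1, kernelFactor n p₀.1 μ + 1, V, hl, hμ', hV, ?_⟩
  have tendsto_re : Tendsto (fun p : Params (n + 1) => p.1.re)
      (𝓝[realContourDomain n] p₀) (𝓝[Set.Ici 1] p₀.1.re) :=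
    tendsto_nhdsWithin_iff.2 ⟨(Continuous.tendsto (by fun_prop) p₀).mono_left nhdsWithin_le_nhds,
      eventually_mem_nhdsWithin.mono fun p hp => hp.1⟩
  have near_re : ∀ᶠ p in 𝓝 p₀, p.1.re < p₀.1.re + 1 :=
    (Continuous.tendsto (by fun_prop) p₀).eventually_lt_const (lt_add_one _)
  have near_t_im : ∀ᶠ p in 𝓝 p₀, ‖fun j => (p.2.1 j).im‖ < μ :=
    (Continuous.tendsto (by fun_prop) p₀).eventually_lt_const hμ
  have near_t_re : ∀ᶠ p in 𝓝 p₀, ‖offset p‖ < ‖offset p₀‖ + 1 :=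
    (Continuous.tendsto (by fun_prop) p₀).eventually_lt_const (lt_add_one _)
  have near_u : ∀ᶠ p in 𝓝 p₀,
      (fun j => (p.2.2 j).im) ∈ convexHull ℝ (V : Set (Fin (n + 1) → ℝ)) :=
    ContinuousAt.eventually_mem (f := fun p : Params (n + 1) =>
      fun j => (p.2.2 j).im) (by fun_prop) hull_mem
  have near_factor : ∀ᶠ p in 𝓝 p₀, kernelFactor n p.1 μ < kernelFactor n p₀.1 μ + 1 :=
    (continuous_factor.tendsto p₀).eventually_lt_const (lt_add_one _)
  filter_upwards [tendsto_re.eventually l_le, nhdsWithin_le_nhds near_re,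
    nhdsWithin_le_nhds near_t_im, nhdsWithin_le_nhds near_t_re, nhdsWithin_le_nhds near_u,
    nhdsWithin_le_nhds near_factor] with p h_ge h_le h_im h_re h_mem h_factor
  exact ⟨h_ge, h_le.le, fun j => (norm_le_pi_norm _ j).trans h_im.le,
    fun j => (norm_le_pi_norm (offset p) j).trans h_re.le, h_mem, h_factor.le⟩

theorem exists_integrable_bound {p₀ : Params (n + 1)} (hp₀ : p₀ ∈ realContourDomain n) :
    ∃ U ∈ 𝓝[realContourDomain n] p₀, ∃ bound : (Fin n → ℝ) → ℝ, Integrable bound ∧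
      ∀ᵐ s, ∀ p ∈ U, ‖realIntegrand p s‖ ≤ bound s := by
  obtain ⟨l, L, μ, M, C, V, hl, hμ, hV, near⟩ := exists_uniform_bounds hp₀
  set B : (Fin n → ℝ) → ℝ≥0∞ := fun s => ENNReal.ofReal C *
    (ENNReal.ofReal ((Real.exp M ^ (n * (n + 1)) * (n + 1).superFactorial) ^ L) *
      ∑ w ∈ V, ENNReal.ofReal (stepDensity l (fun j : Fin (n + 1) => (j : ℝ)) s) *
        majorant n l s (dropLast w)) with hB
  have measurable_summand (w : Fin (n + 1) → ℝ) : Measurable fun s : Fin n → ℝ =>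
      ENNReal.ofReal (stepDensity l (fun j : Fin (n + 1) => (j : ℝ)) s) *
        majorant n l s (dropLast w) := measurable_majorant_integrand l _ (dropLast w)
  have measurable_B : Measurable B :=
    ((Finset.measurable_fun_sum V fun w _ => measurable_summand w).const_mul _).const_mul _
  have lintegral_B : ∫⁻ s, B s ≠ ∞ := by
    rw [hB, lintegral_const_mul' _ _ ENNReal.ofReal_ne_top,
      lintegral_const_mul' _ _ ENNReal.ofReal_ne_top,
      lintegral_finsetSum _ fun w _ => measurable_summand w]
    refine ENNReal.mul_ne_top ENNReal.ofReal_ne_top (ENNReal.mul_ne_top ENNReal.ofReal_ne_top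
      (ENNReal.sum_ne_top.2 fun w hw => ?_))
    exact lintegral_stepDensity_mul_majorant_ne_top hl
      (Nat.cast_injective.comp Fin.val_injective) (hV w hw).1 (hV w hw).2
  refine ⟨_, near, fun s => (B s).toReal,
    integrable_toReal_of_lintegral_ne_top measurable_B.aemeasurable lintegral_B, ?_⟩
  filter_upwards [ae_lt_top measurable_B lintegral_B] with s hs p ⟨hlam, hL, ht_im, ht_re, hu, hC⟩
  rw [← toReal_enorm]
  exact ENNReal.toReal_mono hs.ne (enorm_stepIntegrand_le_sum (by linarith) hlam hL ht_im hμ ht_re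
    hu hC s)

/-! ### Holomorphic parameter integrals -/

theorem aestronglyMeasurable_of_apply {𝕜 E G α : Type*} [NontriviallyNormedField 𝕜]
    [CompleteSpace 𝕜] [NormedAddCommGroup E] [NormedSpace 𝕜 E] [FiniteDimensional 𝕜 E]
    [NormedAddCommGroup G] [NormedSpace 𝕜 G] [MeasurableSpace α] {μ : Measure α}
    {L : α → E →L[𝕜] G} (hL : ∀ v, AEStronglyMeasurable (fun a => L a v) μ) :
    AEStronglyMeasurable L μ := by
  set b := Module.finBasis 𝕜 E
  set coord : Fin (Module.finrank 𝕜 E) → E →L[𝕜] 𝕜 := fun i =>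
    LinearMap.toContinuousLinearMap (b.coord i)
  have expansion : L = fun a =>
      ∑ i, ContinuousLinearMap.smulRightL 𝕜 E G (coord i) (L a (b i)) := by
    ext a v
    conv_lhs => rw [← b.sum_repr v, map_sum]
    simp [coord]
  rw [expansion]
  exact Finset.aestronglyMeasurable_fun_sum _ fun i _ =>
    (ContinuousLinearMap.continuous _).comp_aestronglyMeasurable (hL (b i))

theorem aestronglyMeasurable_fderiv {E G α : Type*} [NormedAddCommGroup E] [NormedSpace ℂ E]
    [FiniteDimensional ℂ E] [NormedAddCommGroup G] [NormedSpace ℂ G] [MeasurableSpace α]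
    {μ : Measure α} {f : E → α → G} {p₀ : E}
    (hmeas : ∀ᶠ p in 𝓝 p₀, AEStronglyMeasurable (f p) μ)
    (hd : ∀ᵐ a ∂μ, DifferentiableAt ℂ (fun p => f p a) p₀) :
    AEStronglyMeasurable (fun a => fderiv ℂ (fun p => f p a) p₀) μ := by
  refine aestronglyMeasurable_of_apply fun v => ?_
  have tendsto_p₀ : Tendsto (fun k : ℕ => p₀ + (k : ℂ)⁻¹ • v) atTop (𝓝 p₀) := by
    simpa using ((tendsto_inv_atTop_nhds_zero_nat (𝕜 := ℂ)).smul_const v).const_add p₀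
  obtain ⟨N, hN⟩ := eventually_atTop.1 (tendsto_p₀.eventually hmeas)
  refine aestronglyMeasurable_of_tendsto_ae atTop (f := fun (k : ℕ) a =>
    ((k + N : ℕ) : ℂ) • (f (p₀ + ((k + N : ℕ) : ℂ)⁻¹ • v) a - f p₀ a)) (fun k => ?_) ?_
  · exact ((hN _ (Nat.le_add_left N k)).sub hmeas.self_of_nhds).const_smul ((k + N : ℕ) : ℂ)
  · refine hd.mono fun a ha => ha.hasFDerivAt.lim v ?_
    simp_rw [Complex.norm_natCast]
    exact tendsto_natCast_atTop_atTop.comp (tendsto_add_atTop_nat N)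

theorem differentiableAt_integral_of_dominated {E G α : Type*} [NormedAddCommGroup E]
    [NormedSpace ℂ E] [FiniteDimensional ℂ E] [NormedAddCommGroup G] [NormedSpace ℂ G]
    [MeasurableSpace α] {μ : Measure α} {f : E → α → G} {U : Set E} {p₀ : E} (hU : U ∈ 𝓝 p₀)
    (hmeas : ∀ p ∈ U, AEStronglyMeasurable (f p) μ)
    (hd : ∀ᵐ a ∂μ, DifferentiableOn ℂ (fun p => f p a) U) {bound : α → ℝ}
    (hb : Integrable bound μ) (hle : ∀ᵐ a ∂μ, ∀ p ∈ U, ‖f p a‖ ≤ bound a) :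
    DifferentiableAt ℂ (fun p => ∫ a, f p a ∂μ) p₀ := by
  obtain ⟨r, hr, ball_subset⟩ : ∃ r > 0, ∀ p ∈ Metric.ball p₀ r, Metric.ball p r ⊆ U := by
    obtain ⟨ε, hε, hεU⟩ := Metric.mem_nhds_iff.1 hU
    exact ⟨ε / 2, half_pos hε, fun p hp => (Metric.ball_subset_ball' (by
      linarith [Metric.mem_ball.1 hp])).trans hεU⟩
  have hp₀ : p₀ ∈ U := mem_of_mem_nhds hU
  -- Cauchy's estimate turns the bound on `f` into one on its derivative.
  have fderiv_bound : ∀ᵐ a ∂μ, ∀ p ∈ Metric.ball p₀ r,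
      ‖fderiv ℂ (fun p => f p a) p‖ ≤ (bound a + bound a) / r := by
    filter_upwards [hd, hle] with a hda ha p hp
    refine Complex.norm_fderiv_le_div_of_mapsTo_ball (hda.mono (ball_subset p hp))
      (fun q hq => ?_) hr
    rw [mem_closedBall_iff_norm]
    exact norm_sub_le_of_le (ha q (ball_subset p hp hq))
      (ha p (ball_subset p hp (Metric.mem_ball_self hr)))
  exact (hasFDerivAt_integral_of_dominated_of_fderiv_le
    (F' := fun p a => fderiv ℂ (fun p => f p a) p) (Metric.ball_mem_nhds p₀ hr)
    (eventually_of_mem hU hmeas) (hb.mono' (hmeas p₀ hp₀) (hle.mono fun a ha => ha p₀ hp₀))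
    (aestronglyMeasurable_fderiv (eventually_of_mem hU hmeas)
      (hd.mono fun a ha => ha.differentiableAt hU))
    fderiv_bound ((hb.add hb).div_const r)
    (hd.mono fun a ha p hp => (ha.differentiableAt (mem_of_superset
      (Metric.ball_mem_nhds p hr) (ball_subset p hp))).hasFDerivAt)).differentiableAt

theorem eq_of_differentiableOn_of_add_ofReal {G : Type*} [NormedAddCommGroup G] [NormedSpace ℂ G]
    {f : ℂ → G} {S : Set ℂ} (hS : IsOpen S) (hS' : IsPreconnected S) (hf : DifferentiableOn ℂ f S)
    (hper : ∀ (z : ℂ) (r : ℝ), f (z + r) = f z) {z w : ℂ} (hz : z ∈ S) (hw : w ∈ S) :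
    f z = f w := by
  refine hS.is_const_of_deriv_eq_zero hS' hf (fun z hz => ?_) hz hw
  have deriv_line : HasDerivAt (fun r : ℝ => z + (r : ℂ)) 1 0 :=
    (hasDerivAt_id (0 : ℝ)).ofReal_comp.const_add z
  have deriv_at : HasDerivAt f (deriv f z) (z + ((0 : ℝ) : ℂ)) := by
    simpa using (hf.differentiableAt (hS.mem_nhds hz)).hasDerivAt
  have deriv_along_reals : HasDerivAt (fun r : ℝ => f (z + r)) (deriv f z) 0 := by
    simpa [Function.comp_def] using
      HasDerivAt.scomp (h := fun r : ℝ => z + (r : ℂ)) 0 deriv_at deriv_line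
  simp_rw [hper] at deriv_along_reals
  exact deriv_along_reals.unique (hasDerivAt_const _ _)

/-! ### Regularity of the integral over the real contour -/

theorem abs_relative_im_le (t : Fin n → ℂ) (j : Fin n) : |(relative t j).im| ≤ maxIm t :=
  le_ciSup (Set.finite_range fun j => |(relative t j).im|).bddAbove j

theorem ofRealVec_mem_reducedDomain (s : Fin n → ℝ) : ofRealVec s ∈ reducedDomain n := by
  have relative_im (j : Fin n) : (relative (ofRealVec s) j).im = 0 := by
    have : relative (ofRealVec s) j = ((s j - (∑ k, s k) / n : ℝ) : ℂ) := by
      simp [relative, mean, ofRealVec]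
    rw [this, Complex.ofReal_im]
  have maxIm_eq : maxIm (ofRealVec s) = 0 := by simp [maxIm, relative_im]
  rw [reducedDomain, Set.mem_ofPred_eq, maxIm_eq]
  positivity

/-- The interior of `realContourDomain n`. -/
def openContourDomain (n : ℕ) : Set (Params (n + 1)) :=
  {p | 1 < p.1.re ∧ (∀ j, |(p.2.1 j).im| < Real.pi / 2) ∧
    ∀ j k, |(p.2.2 j - p.2.2 k).im| < 2 * p.1.re}

theorem openContourDomain_subset (n : ℕ) : openContourDomain n ⊆ realContourDomain n :=
  fun _ hp => ⟨hp.1.le, hp.2⟩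

theorem isOpen_openContourDomain (n : ℕ) : IsOpen (openContourDomain n) := by
  refine isOpen_iff_eventually.2 fun p ⟨hlam, ht, hu⟩ => .and ?_ (.and ?_ ?_)
  · exact (Continuous.tendsto (by fun_prop) p).eventually_const_lt hlam
  · exact eventually_all.2 fun j => (Continuous.tendsto (by fun_prop) p).eventually_lt_const (ht j)
  · exact eventually_all.2 fun j => eventually_all.2 fun k =>
      (Continuous.tendsto (by fun_prop) p).eventually_lt
        (Continuous.tendsto (by fun_prop) p) (hu j k)

theorem two_mul_cosh_mem_slitPlane {z : ℂ} (hz : |z.im| < Real.pi / 2) :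
    2 * Complex.cosh z ∈ Complex.slitPlane := by
  have re_pos : 0 < (Complex.cosh z).re := by
    rw [re_cosh]
    exact mul_pos (Real.cosh_pos _) (Real.cos_pos_of_mem_Ioo (abs_lt.1 hz))
  left
  simpa using re_pos

theorem differentiableAt_finsetProd {ι E : Type*} [NormedAddCommGroup E] [NormedSpace ℂ E]
    {I : Finset ι} {f : ι → E → ℂ} {x : E} (hf : ∀ i ∈ I, DifferentiableAt ℂ (f i) x) :
    DifferentiableAt ℂ (fun y => ∏ i ∈ I, f i y) x := by
  classical
  exact (HasFDerivAt.finsetProd fun i hi => (hf i hi).hasFDerivAt).differentiableAt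

theorem differentiableAt_weight (s : Fin n → ℝ) {lam : ℂ} (hl : lam ≠ 0) :
    DifferentiableAt ℂ (fun lam => weight lam (ofRealVec s)) lam :=
  differentiableAt_finsetProd fun _ _ => differentiableAt_finsetProd fun _ _ =>
    differentiableAt_fun_id.const_cpow (Or.inr hl)

theorem differentiableAt_kernel (s : Fin n → ℝ) {q : ℂ × (Fin (n + 1) → ℂ)}
    (hq : ∀ j, |(q.2 j).im| < Real.pi / 2) :
    DifferentiableAt ℂ (fun q : ℂ × (Fin (n + 1) → ℂ) => kernel q.1 q.2 (ofRealVec s)) q := by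
  refine differentiableAt_finsetProd fun j _ => differentiableAt_finsetProd fun k _ => ?_
  have mem_slitPlane : 2 * Complex.cosh (q.2 j - ofRealVec s k) ∈ Complex.slitPlane :=
    two_mul_cosh_mem_slitPlane (by simpa [ofRealVec] using hq j)
  exact DifferentiableAt.cpow (by fun_prop) (by fun_prop) mem_slitPlane

/-- The parameters at which `F n` enters the integrand of the recursion step. -/
def innerParams (p : Params (n + 1)) (s : Fin n → ℝ) : Params n :=
  (p.1, ofRealVec s, dropLast p.2.2)

theorem innerParams_mem_extDomain {p : Params (n + 1)} (hp : p ∈ realContourDomain n)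
    (s : Fin n → ℝ) : innerParams p s ∈ extDomain n :=
  ⟨hp.1, ofRealVec_mem_reducedDomain s, fun j k => by
    simpa [innerParams, dropLast] using hp.2.2 j.castSucc k.castSucc⟩

theorem innerParams_mem_holoDomain {p : Params (n + 1)} (hp : p ∈ openContourDomain n)
    (s : Fin n → ℝ) : innerParams p s ∈ holoDomain n :=
  ⟨hp.1, (innerParams_mem_extDomain (openContourDomain_subset n hp) s).2⟩

theorem differentiable_innerParams (s : Fin n → ℝ) :
    Differentiable ℂ fun p : Params (n + 1) => innerParams p s := by
  unfold innerParams dropLast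
  fun_prop

theorem realIntegrand_eq (p : Params (n + 1)) (s : Fin n → ℝ) :
    realIntegrand p s = weight p.1 (ofRealVec s) * kernel p.1 p.2.1 (ofRealVec s) *
      F n (innerParams p s).1 (innerParams p s).2.1 (innerParams p s).2.2 :=
  stepIntegrand_zero _ _ _ _ _

theorem differentiableAt_weight_mul_kernel (s : Fin n → ℝ) {p : Params (n + 1)}
    (hp : p ∈ realContourDomain n) :
    DifferentiableAt ℂ (fun p : Params (n + 1) =>
      weight p.1 (ofRealVec s) * kernel p.1 p.2.1 (ofRealVec s)) p := by
  have hl : p.1 ≠ 0 := fun h => by simpa [h] using zero_lt_one.trans_le hp.1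
  exact ((differentiableAt_weight s hl).comp p differentiableAt_fst).mul
    ((differentiableAt_kernel s (q := (p.1, p.2.1)) hp.2.1).comp p
      (f := fun p : Params (n + 1) => (p.1, p.2.1)) (by fun_prop))

/-- Part (b) of the theorem, as the induction hypothesis of the recursion in `n`. -/
structure Regular (n : ℕ) : Prop where
  continuousOn : ContinuousOn (fun p : Params n => F n p.1 p.2.1 p.2.2) (extDomain n)
  differentiableOn : DifferentiableOn ℂ (fun p : Params n => F n p.1 p.2.1 p.2.2) (holoDomain n)

theorem Regular.aestronglyMeasurable_realIntegrand (h : Regular n) {p : Params (n + 1)}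
    (hp : p ∈ realContourDomain n) : AEStronglyMeasurable (realIntegrand p) := by
  have measurable_weight : Measurable fun s : Fin n → ℝ => weight p.1 (ofRealVec s) := by
    unfold weight ofRealVec
    fun_prop
  have measurable_kernel : Measurable fun s : Fin n → ℝ => kernel p.1 p.2.1 (ofRealVec s) := by
    unfold kernel ofRealVec
    fun_prop
  have continuous_inner : Continuous fun s : Fin n → ℝ => innerParams p s := by
    unfold innerParams ofRealVec
    fun_prop
  simp_rw [funext (realIntegrand_eq p)]
  exact (measurable_weight.mul measurable_kernel).aestronglyMeasurable.mul
    (h.continuousOn.comp_continuous continuous_inner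
      (innerParams_mem_extDomain hp)).aestronglyMeasurable

theorem Regular.continuousOn_realIntegrand (h : Regular n) (s : Fin n → ℝ) :
    ContinuousOn (fun p => realIntegrand p s) (realContourDomain n) := by
  simp_rw [realIntegrand_eq]
  exact ContinuousOn.mul
    (fun p hp => (differentiableAt_weight_mul_kernel s hp).continuousAt.continuousWithinAt)
    (h.continuousOn.comp (differentiable_innerParams s).continuous.continuousOn
      fun p hp => innerParams_mem_extDomain hp s)

theorem Regular.differentiableOn_realIntegrand (h : Regular n) (s : Fin n → ℝ) :
    DifferentiableOn ℂ (fun p => realIntegrand p s) (openContourDomain n) := by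
  simp_rw [realIntegrand_eq]
  exact DifferentiableOn.mul
    (fun p hp => (differentiableAt_weight_mul_kernel s
      (openContourDomain_subset n hp)).differentiableWithinAt)
    (h.differentiableOn.comp (differentiable_innerParams s).differentiableOn
      fun p hp => innerParams_mem_holoDomain hp s)

theorem Regular.integrable_realIntegrand (h : Regular n) {p : Params (n + 1)}
    (hp : p ∈ realContourDomain n) : Integrable (realIntegrand p) := by
  obtain ⟨U, hU, bound, integrable_bound, le_bound⟩ := exists_integrable_bound hp
  exact integrable_bound.mono' (h.aestronglyMeasurable_realIntegrand hp)
    (le_bound.mono fun s hs => hs p (mem_of_mem_nhdsWithin hp hU))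

/-- The integral of the recursion step taken over the real contour. -/
def contourIntegral (p : Params (n + 1)) : ℂ :=
  ∫ s, realIntegrand p s

theorem Regular.continuousOn_contourIntegral (h : Regular n) :
    ContinuousOn contourIntegral (realContourDomain n) := by
  intro p hp
  obtain ⟨U, hU, bound, integrable_bound, le_bound⟩ := exists_integrable_bound hp
  exact continuousWithinAt_of_dominated
    (eventually_mem_nhdsWithin.mono fun q hq => h.aestronglyMeasurable_realIntegrand hq)
    (eventually_of_mem hU fun q hq => le_bound.mono fun s hs => hs q hq) integrable_bound
    (.of_forall fun s => h.continuousOn_realIntegrand s p hp)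

theorem Regular.differentiableAt_contourIntegral_comp (h : Regular n) {E : Type*}
    [NormedAddCommGroup E] [NormedSpace ℂ E] [FiniteDimensional ℂ E] {φ : E → Params (n + 1)}
    {x : E} (hφ : ContinuousAt φ x) {S : Set E} (hS : S ∈ 𝓝 x)
    (hmaps : Set.MapsTo φ S (realContourDomain n))
    (hd : ∀ s, DifferentiableOn ℂ (fun y => realIntegrand (φ y) s) S) :
    DifferentiableAt ℂ (fun y => contourIntegral (φ y)) x := by
  obtain ⟨U, hU, bound, integrable_bound, le_bound⟩ :=
    exists_integrable_bound (hmaps (mem_of_mem_nhds hS))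
  have preimage_mem : φ ⁻¹' U ∈ 𝓝 x :=
    tendsto_nhdsWithin_iff.2 ⟨hφ.tendsto, eventually_of_mem hS hmaps⟩ hU
  exact differentiableAt_integral_of_dominated (inter_mem hS preimage_mem)
    (fun y hy => h.aestronglyMeasurable_realIntegrand (hmaps hy.1))
    (.of_forall fun s => (hd s).mono Set.inter_subset_left) integrable_bound
    (le_bound.mono fun s hs y hy => hs (φ y) hy.2)

theorem Regular.differentiableOn_contourIntegral (h : Regular n) :
    DifferentiableOn ℂ contourIntegral (openContourDomain n) := fun _ hp =>
  (h.differentiableAt_contourIntegral_comp continuousAt_id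
    ((isOpen_openContourDomain n).mem_nhds hp) (openContourDomain_subset n)
    h.differentiableOn_realIntegrand).differentiableWithinAt

/-! ### The contour shift -/

theorem abs_im_sub_lt_pi {t : Fin n → ℂ} (ht : ∀ j, |(t j).im| < Real.pi / 2) (j k : Fin n) :
    |(t j - t k).im| < Real.pi := by
  rw [Complex.sub_im]
  linarith [abs_sub (t j).im (t k).im, ht j, ht k]

theorem abs_im_sub_lt_pi_of_mem {t : Fin n → ℂ} (ht : t ∈ reducedDomain n) (j k : Fin n) :
    |(t j - t k).im| < Real.pi := by
  have := abs_im_sub_lt_pi (fun j => (abs_relative_im_le t j).trans_lt ht) j k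
  rwa [relative, relative, sub_sub_sub_cancel_right] at this

theorem abs_im_sub_midHeight_lt {t : Fin (n + 1) → ℂ} (ht : ∀ j k, |(t j - t k).im| < Real.pi)
    (j : Fin (n + 1)) : |(t j - Complex.I * midHeight t).im| < Real.pi / 2 := by
  obtain ⟨a, ha⟩ := exists_eq_ciSup_of_finite (f := fun j => (t j).im)
  obtain ⟨b, hb⟩ := exists_eq_ciInf_of_finite (f := fun j => (t j).im)
  have le_max : (t j).im ≤ (t a).im :=
    ha ▸ le_ciSup (Set.finite_range fun j => (t j).im).bddAbove j
  have min_le : (t b).im ≤ (t j).im :=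
    hb ▸ ciInf_le (Set.finite_range fun j => (t j).im).bddBelow j
  have im_eq : (t j - Complex.I * midHeight t).im = (t j).im - ((t a).im + (t b).im) / 2 := by
    simp [midHeight, ← ha, ← hb]
  have max_sub_min : (t a).im - (t b).im < Real.pi := by
    simpa using (abs_lt.1 (ht a b)).2
  rw [im_eq, abs_lt]
  constructor <;> linarith

/-- The strip of translations of `t` that keep all imaginary parts below `π / 2`. -/
def shiftStrip (t : Fin n → ℂ) : Set ℂ :=
  ⋂ j, Complex.im ⁻¹' Metric.ball (t j).im (Real.pi / 2)

theorem mem_shiftStrip {t : Fin n → ℂ} {z : ℂ} :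
    z ∈ shiftStrip t ↔ ∀ j, |(t j - z).im| < Real.pi / 2 := by
  simp [shiftStrip, Real.dist_eq, abs_sub_comm]

theorem isOpen_shiftStrip (t : Fin n → ℂ) : IsOpen (shiftStrip t) :=
  isOpen_iInter_of_finite fun _ => Metric.isOpen_ball.preimage Complex.continuous_im

theorem convex_shiftStrip (t : Fin n → ℂ) : Convex ℝ (shiftStrip t) :=
  convex_iInter fun _ => (convex_ball _ _).linear_preimage Complex.imLm

/-- The contour integral after a translation of `t`, normalized so as not to depend on real
translations. -/
def shiftedIntegral (lam : ℂ) (t u : Fin (n + 1) → ℂ) (z : ℂ) : ℂ :=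
  Complex.exp (Complex.I * z * ∑ j, dropLast u j) * contourIntegral (lam, fun j => t j - z, u)

theorem contourIntegral_add_ofReal (lam : ℂ) (t u : Fin (n + 1) → ℂ) (r : ℝ) :
    contourIntegral (lam, fun j => t j + r, u) =
      Complex.exp (Complex.I * r * ∑ j, dropLast u j) * contourIntegral (lam, t, u) := by
  rw [contourIntegral, ← integral_add_right_eq_self _ (fun _ : Fin n => r), contourIntegral,
    ← integral_const_mul]
  refine integral_congr_ae (.of_forall fun s => ?_)
  simpa [realIntegrand, Pi.add_def] using
    stepIntegrand_add_const (fun s u c => F_add_const lam s u c) lam t u 0 (r : ℂ) s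

theorem shiftedIntegral_add_ofReal (lam : ℂ) (t u : Fin (n + 1) → ℂ) (z : ℂ) (r : ℝ) :
    shiftedIntegral lam t u (z + r) = shiftedIntegral lam t u z := by
  have shift := contourIntegral_add_ofReal lam (fun j => t j - (z + r)) u r
  simp only [sub_add_eq_sub_sub, sub_add_cancel] at shift
  simp only [shiftedIntegral, sub_add_eq_sub_sub]
  rw [shift, ← mul_assoc, ← Complex.exp_add, mul_add, add_mul]

theorem Regular.differentiableOn_shiftedIntegral (h : Regular n) {lam : ℂ}
    {t u : Fin (n + 1) → ℂ} (hl : 1 ≤ lam.re) (hu : ∀ j k, |(u j - u k).im| < 2 * lam.re) :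
    DifferentiableOn ℂ (shiftedIntegral lam t u) (shiftStrip t) := by
  have maps_strip : Set.MapsTo (fun z : ℂ => ((lam, fun j => t j - z, u) : Params (n + 1)))
      (shiftStrip t) (realContourDomain n) := fun z hz => ⟨hl, mem_shiftStrip.1 hz, hu⟩
  have differentiableOn_integrand (s : Fin n → ℝ) : DifferentiableOn ℂ
      (fun z => realIntegrand (lam, fun j => t j - z, u) s) (shiftStrip t) := fun z hz => by
    simp_rw [realIntegrand_eq, innerParams]
    exact (DifferentiableAt.mul_const ((differentiableAt_weight_mul_kernel s (maps_strip hz)).comp z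
      (f := fun z : ℂ => ((lam, fun j => t j - z, u) : Params (n + 1))) (by fun_prop))
      _).differentiableWithinAt
  intro z hz
  exact (DifferentiableAt.mul (by fun_prop) (h.differentiableAt_contourIntegral_comp
    (by fun_prop) ((isOpen_shiftStrip t).mem_nhds hz) maps_strip
    differentiableOn_integrand)).differentiableWithinAt

theorem Regular.shiftedIntegral_eq (h : Regular n) {lam : ℂ} {t u : Fin (n + 1) → ℂ}
    (hl : 1 ≤ lam.re) (hu : ∀ j k, |(u j - u k).im| < 2 * lam.re) {z w : ℂ}
    (hz : z ∈ shiftStrip t) (hw : w ∈ shiftStrip t) :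
    shiftedIntegral lam t u z = shiftedIntegral lam t u w :=
  eq_of_differentiableOn_of_add_ofReal (isOpen_shiftStrip t) (convex_shiftStrip t).isPreconnected
    (h.differentiableOn_shiftedIntegral hl hu) (shiftedIntegral_add_ofReal lam t u) hz hw

theorem Regular.integrable_stepIntegrand_midHeight (h : Regular n) {lam : ℂ}
    {t u : Fin (n + 1) → ℂ} (hp : (lam, t, u) ∈ extDomain (n + 1)) :
    Integrable (stepIntegrand (F n lam) lam t u (midHeight t)) := by
  rw [funext (stepIntegrand_eq_stepIntegrand_zero lam t u (midHeight t))]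
  exact (h.integrable_realIntegrand (p := (lam, fun j => t j - Complex.I * midHeight t, u))
    ⟨hp.1, abs_im_sub_midHeight_lt (abs_im_sub_lt_pi_of_mem hp.2.1), hp.2.2⟩).const_mul _

theorem integral_stepIntegrand_eq_shiftedIntegral (lam : ℂ) (t u : Fin (n + 1) → ℂ) (c : ℝ) :
    ∫ s, stepIntegrand (F n lam) lam t u c s = shiftedIntegral lam t u (Complex.I * c) := by
  simp_rw [stepIntegrand_eq_stepIntegrand_zero lam t u c]
  exact integral_const_mul _ _

theorem Regular.integral_stepIntegrand_midHeight (h : Regular n) {lam : ℂ}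
    {t u : Fin (n + 1) → ℂ} (hp : (lam, t, u) ∈ realContourDomain n) :
    ∫ s, stepIntegrand (F n lam) lam t u (midHeight t) s = contourIntegral (lam, t, u) := by
  obtain ⟨hl, ht, hu⟩ := hp
  calc ∫ s, stepIntegrand (F n lam) lam t u (midHeight t) s
      = shiftedIntegral lam t u (Complex.I * midHeight t) :=
        integral_stepIntegrand_eq_shiftedIntegral lam t u _
    _ = shiftedIntegral lam t u 0 := h.shiftedIntegral_eq hl hu
        (mem_shiftStrip.2 (abs_im_sub_midHeight_lt (abs_im_sub_lt_pi ht)))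
        (mem_shiftStrip.2 (by simpa using ht))
    _ = contourIntegral (lam, t, u) := by simp [shiftedIntegral]

theorem natCast_mul_mean (t : Fin (n + 1) → ℂ) : ((n + 1 : ℕ) : ℂ) * mean t = ∑ j, t j :=
  mul_div_cancel₀ _ (Nat.cast_ne_zero.2 n.succ_ne_zero)

theorem sum_relative (t : Fin (n + 1) → ℂ) : ∑ j, relative t j = 0 := by
  simp only [relative, Finset.sum_sub_distrib, Finset.sum_const, Finset.card_univ,
    Fintype.card_fin, nsmul_eq_mul, natCast_mul_mean, sub_self]

/-- The parameters at which `contourIntegral` enters `reducedF`. -/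
def relativeParams (p : Params (n + 1)) : Params (n + 1) :=
  (p.1, relative p.2.1, p.2.2)

theorem relativeParams_mem_realContourDomain {p : Params (n + 1)} (hp : p ∈ extDomain (n + 1)) :
    relativeParams p ∈ realContourDomain n :=
  ⟨hp.1, fun j => (abs_relative_im_le p.2.1 j).trans_lt hp.2.1, hp.2.2⟩

theorem relativeParams_mem_openContourDomain {p : Params (n + 1)} (hp : p ∈ holoDomain (n + 1)) :
    relativeParams p ∈ openContourDomain n :=
  ⟨hp.1, (relativeParams_mem_realContourDomain ⟨hp.1.le, hp.2⟩).2⟩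

theorem Regular.integrable_stepIntegrand_relative (h : Regular n) {lam : ℂ}
    {t u : Fin (n + 1) → ℂ} (hp : (lam, t, u) ∈ extDomain (n + 1)) :
    Integrable (stepIntegrand (F n lam) lam (relative t) u 0) :=
  h.integrable_realIntegrand (p := (lam, relative t, u)) (relativeParams_mem_realContourDomain hp)

theorem reducedF_eq (p : Params (n + 1)) :
    reducedF p.1 p.2.1 p.2.2 = 1 / (n.factorial : ℂ) * contourIntegral (relativeParams p) :=
  rfl

theorem Regular.F_succ_eq (h : Regular n) {lam : ℂ} {t u : Fin (n + 1) → ℂ}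
    (hp : (lam, t, u) ∈ extDomain (n + 1)) :
    F (n + 1) lam t u =
      Complex.exp (Complex.I * ((n + 1 : ℕ) : ℂ) * mean t * mean u) * reducedF lam t u := by
  calc F (n + 1) lam t u = F (n + 1) lam (fun j => relative t j + mean t) u := by
        simp only [relative, sub_add_cancel]
    _ = Complex.exp (Complex.I * mean t * ∑ j, u j) * F (n + 1) lam (relative t) u :=
        F_add_const _ _ _ _
    _ = Complex.exp (Complex.I * mean t * ∑ j, u j) * reducedF lam t u := by
        rw [F, sum_relative, mul_zero, Complex.exp_zero, h.integral_stepIntegrand_midHeight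
          (relativeParams_mem_realContourDomain hp)]
        rfl
    _ = _ := by
        rw [← natCast_mul_mean]
        congr 2
        ring

theorem differentiable_prefactor : Differentiable ℂ fun p : Params (n + 1) =>
    Complex.exp (Complex.I * ((n + 1 : ℕ) : ℂ) * mean p.2.1 * mean p.2.2) *
      (1 / (n.factorial : ℂ)) := by
  unfold mean
  fun_prop

theorem differentiable_relativeParams :
    Differentiable ℂ (relativeParams : Params (n + 1) → Params (n + 1)) := by
  unfold relativeParams relative mean
  fun_prop

theorem Regular.F_succ_eq_mul_contourIntegral (h : Regular n) {p : Params (n + 1)}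
    (hp : p ∈ extDomain (n + 1)) :
    F (n + 1) p.1 p.2.1 p.2.2 =
      Complex.exp (Complex.I * ((n + 1 : ℕ) : ℂ) * mean p.2.1 * mean p.2.2) *
        (1 / (n.factorial : ℂ)) * contourIntegral (relativeParams p) := by
  rw [h.F_succ_eq hp, reducedF_eq, ← mul_assoc (Complex.exp _)]

theorem regular (n : ℕ) : Regular n := by
  induction n with
  | zero => exact ⟨continuousOn_const, differentiableOn_const _⟩
  | succ n ih =>
    constructor
    · refine ContinuousOn.congr ?_ fun p hp => ih.F_succ_eq_mul_contourIntegral hp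
      exact differentiable_prefactor.continuous.continuousOn.mul
        (ih.continuousOn_contourIntegral.comp differentiable_relativeParams.continuous.continuousOn
          fun p hp => relativeParams_mem_realContourDomain hp)
    · refine DifferentiableOn.congr ?_ fun p hp =>
        ih.F_succ_eq_mul_contourIntegral ⟨hp.1.le, hp.2⟩
      exact differentiable_prefactor.differentiableOn.mul
        (ih.differentiableOn_contourIntegral.comp differentiable_relativeParams.differentiableOn
          fun p hp => relativeParams_mem_openContourDomain hp)

/-! ### The bound by the alternating sum -/

theorem enorm_reducedF_le {lam : ℂ} (hl : 0 < lam.re) {t : Fin (n + 1) → ℂ}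
    (ht : t ∈ reducedDomain (n + 1)) (u : Fin (n + 1) → ℂ) :
    ‖reducedF lam t u‖ₑ ≤ ENNReal.ofReal (kernelFactor n lam (maxIm t)) *
      majorant (n + 1) lam.re (fun j => (relative t j).re) (fun j => (u j).im) := by
  have sum_re : ∑ j, (relative t j).re = 0 := by
    rw [← Complex.re_sum, sum_relative, Complex.zero_re]
  have enorm_factorial : ‖1 / (n.factorial : ℂ)‖ₑ = ENNReal.ofReal (1 / n.factorial) := by
    rw [← ofReal_norm, norm_div, norm_one, Complex.norm_natCast]
  rw [reducedF, enorm_mul, enorm_factorial, majorant, sum_re, mul_zero, neg_zero, Real.exp_zero,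
    mul_left_comm]
  refine mul_le_mul_right ((enorm_integral_le_lintegral_enorm _).trans ?_) _
  rw [← lintegral_const_mul' _ _ ENNReal.ofReal_ne_top]
  exact lintegral_mono fun s => enorm_stepIntegrand_le hl (abs_relative_im_le t) ht u s

/-- The variables `Re lam * Re t^{(N)}` of the comparison with coupling one. -/
def scaledRe {N : ℕ} (lam : ℂ) (t : Fin N → ℂ) : Fin N → ℝ :=
  lam.re • fun j => (relative t j).re

/-- The spectral parameters `Im u / Re lam` of the comparison with coupling one. -/
def scaledIm {N : ℕ} (lam : ℂ) (u : Fin N → ℂ) : Fin N → ℝ :=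
  lam.re⁻¹ • fun j => (u j).im

theorem scaledRe_sub_scaledRe (lam : ℂ) (t : Fin n → ℂ) (j k : Fin n) :
    scaledRe lam t j - scaledRe lam t k = lam.re * (t j - t k).re := by
  simp only [scaledRe, relative, Pi.smul_apply, smul_eq_mul, Complex.sub_re]
  ring

theorem scaledIm_sub_scaledIm (lam : ℂ) (u : Fin n → ℂ) (j k : Fin n) :
    scaledIm lam u j - scaledIm lam u k = (u j - u k).im / lam.re := by
  simp only [scaledIm, Pi.smul_apply, smul_eq_mul, Complex.sub_im]
  ring

theorem altSum_eq_det {lam : ℂ} (hl : lam.re ≠ 0) (t u : Fin (n + 1) → ℂ) :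
    altSum t u = (expMatrix (scaledRe lam t) (scaledIm lam u)).det := by
  rw [det_expMatrix, altSum]
  refine Finset.sum_congr rfl fun τ _ => ?_
  have sum_re : ∑ j, (relative t (τ j)).re = 0 := by
    rw [Equiv.sum_comp τ fun j => (relative t j).re, ← Complex.re_sum, sum_relative,
      Complex.zero_re]
  have sum_eq : ∑ j, (relative t (τ j)).re * (relative u j).im =
      ∑ j, (relative t (τ j)).re * (u j).im := by
    simp_rw [relative, Complex.sub_im, mul_sub, Finset.sum_sub_distrib, ← Finset.sum_mul]
    simp_rw [relative] at sum_re
    rw [sum_re, zero_mul, sub_zero]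
  rw [sum_eq, ← Real.exp_sum, Finset.sum_neg_distrib]
  congr! 4 with j
  simp only [scaledRe, scaledIm, Pi.smul_apply, smul_eq_mul]
  field_simp

theorem prod_Ioi_const {M : Type*} [CommMonoid M] (n : ℕ) (c : M) :
    ∏ j : Fin n, ∏ _k ∈ Finset.Ioi j, c = c ^ n.choose 2 := by
  induction n with
  | zero => simp
  | succ n ih =>
    simp_rw [Fin.prod_univ_succ, Fin.prod_Ioi_zero, Fin.prod_Ioi_succ, ih]
    simp [Nat.choose_succ_succ', pow_add]

theorem sinProd_mul_sinhProd (lam : ℂ) (t u : Fin n → ℂ) :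
    sinProd (scaledIm lam u) * sinhProd (scaledRe lam t) = 4 ^ n.choose 2 * boundDenom lam t u := by
  simp_rw [sinProd, sinhProd, boundDenom, ← prod_Ioi_const n (4 : ℝ), ← Finset.prod_mul_distrib,
    scaledIm_sub_scaledIm, scaledRe_sub_scaledRe]
  refine Finset.prod_congr rfl fun j _ => Finset.prod_congr rfl fun k _ => ?_
  rw [← mul_div_assoc, div_div, mul_comm lam.re 2]
  ring

theorem majorantOne_scaled {lam : ℂ} (hl : lam.re ≠ 0) (t u : Fin (n + 1) → ℂ) :
    majorantOne (scaledRe lam t) (scaledIm lam u) =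
      (Real.pi / 4) ^ (n + 1).choose 2 * (altSum t u / boundDenom lam t u) := by
  rw [majorantOne, sinProd_mul_sinhProd, ← altSum_eq_det hl, mul_div_mul_comm, div_pow]

theorem scaledRe_injective {lam : ℂ} (hl : lam.re ≠ 0) {t : Fin n → ℂ}
    (ht : ∀ j k, j < k → (t j - t k).re ≠ 0) : Function.Injective (scaledRe lam t) :=
  .of_lt_imp_ne fun j k hjk => sub_ne_zero.1 <| by
    rw [scaledRe_sub_scaledRe]
    exact mul_ne_zero hl (ht j k hjk)

theorem scaledIm_injective {lam : ℂ} (hl : lam.re ≠ 0) {u : Fin n → ℂ}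
    (hu : ∀ j k, j < k → (u j - u k).im ≠ 0) : Function.Injective (scaledIm lam u) :=
  .of_lt_imp_ne fun j k hjk => sub_ne_zero.1 <| by
    rw [scaledIm_sub_scaledIm]
    exact div_ne_zero (hu j k hjk) hl

theorem abs_im_sub_lt {l : ℝ} (hl : 0 < l) {u : Fin n → ℂ}
    (hu : ∀ j k, j < k → |(u j - u k).im| < 2 * l) (j k : Fin n) : |(u j - u k).im| < 2 * l := by
  rcases lt_trichotomy j k with hjk | rfl | hkj
  · exact hu j k hjk
  · simpa using hl
  · rw [← neg_sub, Complex.neg_im, abs_neg]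
    exact hu k j hkj

theorem abs_scaledIm_sub_lt {lam : ℂ} (hl : 0 < lam.re) {u : Fin n → ℂ}
    (hu : ∀ j k, |(u j - u k).im| < 2 * lam.re) (j k : Fin n) :
    |scaledIm lam u j - scaledIm lam u k| < 2 := by
  rw [scaledIm_sub_scaledIm, abs_div, abs_of_pos hl, div_lt_iff₀ hl]
  exact hu j k

theorem norm_exp_I_mul_natCast_mul_mean (t u : Fin n → ℂ) (m : ℕ) :
    ‖Complex.exp (Complex.I * (m : ℂ) * mean t * mean u)‖ =
      Real.exp (-((m : ℝ) * (mean t * mean u).im)) := by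
  rw [Complex.norm_exp, mul_assoc, mul_assoc, Complex.I_mul_re, ← Complex.ofReal_natCast,
    Complex.im_ofReal_mul]

/-- The constant in the bound of `reducedF` by the alternating sum. -/
def boundConst (n : ℕ) (lam : ℂ) (μ : ℝ) : ℝ :=
  kernelFactor n lam μ *
    (2 ^ (∑ m ∈ Finset.range (n + 1), m * (m + 1)) * (Real.pi / 4) ^ (n + 1).choose 2)

theorem continuousOn_boundConst (n : ℕ) :
    ContinuousOn (fun q : ℂ × ℝ => boundConst n q.1 q.2) (Set.univ ×ˢ Set.Ico 0 (Real.pi / 2)) :=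
  (continuousOn_kernelFactor n).mul continuousOn_const

section

variable {lam : ℂ} {t u : Fin (n + 1) → ℂ}

theorem majorant_one_scaled (hl : 0 < lam.re) (ht : ∀ j k, j < k → (t j - t k).re ≠ 0)
    (hu : ∀ j k, j < k → |(u j - u k).im| ∈ Set.Ioo 0 (2 * lam.re)) :
    majorant (n + 1) 1 (scaledRe lam t) (scaledIm lam u) = ENNReal.ofReal
      ((Real.pi / 4) ^ (n + 1).choose 2 * (altSum t u / boundDenom lam t u)) := by
  rw [majorant_one_eq (scaledRe_injective hl.ne' ht)
    (scaledIm_injective hl.ne' fun j k hjk => abs_pos.1 (hu j k hjk).1)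
    (abs_scaledIm_sub_lt hl (abs_im_sub_lt hl fun j k hjk => (hu j k hjk).2)),
    majorantOne_scaled hl.ne']

theorem altSum_div_boundDenom_pos (hl : 0 < lam.re) (ht : ∀ j k, j < k → (t j - t k).re ≠ 0)
    (hu : ∀ j k, j < k → |(u j - u k).im| ∈ Set.Ioo 0 (2 * lam.re)) :
    0 < altSum t u / boundDenom lam t u :=
  pos_of_mul_pos_right
    (ENNReal.ofReal_pos.1 (majorant_one_scaled hl ht hu ▸ majorant_pos 1 _ _)) (by positivity)

theorem norm_reducedF_le (hl : 1 ≤ lam.re) (ht : t ∈ reducedDomain (n + 1))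
    (ht' : ∀ j k, j < k → (t j - t k).re ≠ 0)
    (hu : ∀ j k, j < k → |(u j - u k).im| ∈ Set.Ioo 0 (2 * lam.re)) :
    ‖reducedF lam t u‖ ≤ boundConst n lam (maxIm t) * (altSum t u / boundDenom lam t u) := by
  have hl0 : 0 < lam.re := zero_lt_one.trans_le hl
  have ratio_pos := altSum_div_boundDenom_pos hl0 ht' hu
  have factor_nonneg : 0 ≤ kernelFactor n lam (maxIm t) :=
    kernelFactor_nonneg n lam ((abs_nonneg _).trans (abs_relative_im_le t 0)) ht
  have majorant_le : majorant (n + 1) lam.re (fun j => (relative t j).re) (fun j => (u j).im) ≤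
      ENNReal.ofReal (2 ^ ∑ m ∈ Finset.range (n + 1), m * (m + 1)) *
        ENNReal.ofReal ((Real.pi / 4) ^ (n + 1).choose 2 * (altSum t u / boundDenom lam t u)) := by
    rw [← majorant_one_scaled hl0 ht' hu]
    exact majorant_le_majorant_one hl _ _
  have enorm_le := (enorm_reducedF_le hl0 ht u).trans (mul_le_mul_right majorant_le _)
  rw [← ENNReal.ofReal_mul (by positivity), ← ENNReal.ofReal_mul factor_nonneg, ← ofReal_norm,
    ENNReal.ofReal_le_ofReal_iff (by positivity)] at enorm_le
  simpa only [boundConst, mul_assoc] using enorm_le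

theorem norm_F_lt (hl : 1 ≤ lam.re) (ht : t ∈ reducedDomain (n + 1))
    (ht' : ∀ j k, j < k → (t j - t k).re ≠ 0)
    (hu : ∀ j k, j < k → |(u j - u k).im| ∈ Set.Ioo 0 (2 * lam.re)) :
    ‖F (n + 1) lam t u‖ < (boundConst n lam (maxIm t) + 1) *
      Real.exp (-(((n + 1 : ℕ) : ℝ) * (mean t * mean u).im)) *
        (altSum t u / boundDenom lam t u) := by
  have hl0 : 0 < lam.re := zero_lt_one.trans_le hl
  have mem_extDomain : (lam, t, u) ∈ extDomain (n + 1) :=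
    ⟨hl, ht, abs_im_sub_lt hl0 fun j k hjk => (hu j k hjk).2⟩
  have norm_reducedF_lt : ‖reducedF lam t u‖ <
      (boundConst n lam (maxIm t) + 1) * (altSum t u / boundDenom lam t u) := by
    rw [add_one_mul]
    exact lt_add_of_le_of_pos (norm_reducedF_le hl ht ht' hu)
      (altSum_div_boundDenom_pos hl0 ht' hu)
  rw [(regular n).F_succ_eq mem_extDomain, norm_mul, norm_exp_I_mul_natCast_mul_mean,
    mul_comm _ (Real.exp _), mul_assoc]
  exact mul_lt_mul_of_pos_left norm_reducedF_lt (Real.exp_pos _)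

end

end CalogeroMoser

end

theorem theorem6p4 (n : ℕ) :
    (∀ lam t u, (lam, t, u) ∈ CalogeroMoser.extDomain (n + 1) →
      MeasureTheory.Integrable (fun s : Fin n → ℝ =>
        CalogeroMoser.stepIntegrand (CalogeroMoser.F n lam) lam t u
          (CalogeroMoser.midHeight t) s) ∧
      MeasureTheory.Integrable (fun s : Fin n → ℝ =>
        CalogeroMoser.stepIntegrand (CalogeroMoser.F n lam) lam
          (CalogeroMoser.relative t) u 0 s) ∧
      CalogeroMoser.F (n + 1) lam t u =
        Complex.exp (Complex.I * ((n + 1 : ℕ) : ℂ) *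
          CalogeroMoser.mean t * CalogeroMoser.mean u) *
          CalogeroMoser.reducedF lam t u) ∧
    DifferentiableOn ℂ
      (fun p : ℂ × (Fin (n + 1) → ℂ) × (Fin (n + 1) → ℂ) =>
        CalogeroMoser.F (n + 1) p.1 p.2.1 p.2.2)
      (CalogeroMoser.holoDomain (n + 1)) ∧
    ContinuousOn
      (fun p : ℂ × (Fin (n + 1) → ℂ) × (Fin (n + 1) → ℂ) =>
        CalogeroMoser.F (n + 1) p.1 p.2.1 p.2.2)
      (CalogeroMoser.extDomain (n + 1)) ∧
    ∃ C : ℂ → ℝ → ℝ,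
      ContinuousOn (fun q : ℂ × ℝ => C q.1 q.2)
        ({lam : ℂ | 1 ≤ lam.re} ×ˢ Set.Ico 0 (Real.pi / 2)) ∧
      ∀ (lam : ℂ) (t u : Fin (n + 1) → ℂ),
        1 ≤ lam.re →
        t ∈ CalogeroMoser.reducedDomain (n + 1) →
        (∀ j k, j < k → (t j - t k).re ≠ 0) →
        (∀ j k, j < k → |(u j - u k).im| ∈ Set.Ioo 0 (2 * lam.re)) →
        ‖CalogeroMoser.F (n + 1) lam t u‖ <
          C lam (CalogeroMoser.maxIm t) *
            Real.exp (-(((n + 1 : ℕ) : ℝ) *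
              (CalogeroMoser.mean t * CalogeroMoser.mean u).im)) *
            (CalogeroMoser.altSum t u / CalogeroMoser.boundDenom lam t u) := by
  exact ⟨fun lam t u hp =>
      ⟨(CalogeroMoser.regular n).integrable_stepIntegrand_midHeight hp,
        (CalogeroMoser.regular n).integrable_stepIntegrand_relative hp,
        (CalogeroMoser.regular n).F_succ_eq hp⟩,
    (CalogeroMoser.regular (n + 1)).differentiableOn,
    (CalogeroMoser.regular (n + 1)).continuousOn,
    fun lam μ => CalogeroMoser.boundConst n lam μ + 1,
    ((CalogeroMoser.continuousOn_boundConst n).mono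
      (Set.prod_mono_left (Set.subset_univ _))).add continuousOn_const,
    fun lam t u hl ht ht' hu => CalogeroMoser.norm_F_lt hl ht ht' hu⟩
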